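/- **Setting.** For $n,d\in\mathbb N$, an *isotropic Gaussian sample* consists of random vectors $\mathbf x_1,\dots,\mathbf x_n\in\mathbb R^d$ whose $nd$ coordinates are mutually independent, each $\mathbf x_i\sim\mathcal N(0,I_d)$, together with fixed (non-random) labels $y_1,\dots,y_n\in\{-1,1\}$. The $\ell_2$-SVM problem is to minimize $\|w\|_2$ over $w\in\mathbb R^d$ subject to $y_i w^{\mathsf T}\mathbf x_i\ge 1$ for all $i$. *Support vector proliferation* (SVP) occurs if this problem has a (necessarily unique) solution $w$ and every example is a support vector, i.e. $y_i w^{\mathsf T}\mathbf x_i=1$ for all $i$. **Theorem (sharp SVP phase transition).** For every $c_1>0$ there is a constant $C_2>0$, depending only on $c_1$, such that the following holds. (1) Let $(\varepsilon_n)_{n\ge1}$ be any sequence of positive real numbers with $$\limsup_{n\to\infty}\varepsilon_n<2-c_1\qquad\text{and}\qquad \liminf_{n\to\infty}\varepsilon_n\sqrt{\log n}>C_2 ,$$ where limsup and liminf are taken in $[-\infty,\infty]$. For each $n$ let $d_n\in\mathbb N$, and consider an isotropic Gaussian sample of size $n$ in dimension $d_n$ with arbitrary fixed labels. Then, as $n\to\infty$,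 $$\Pr[\text{SVP occurs for the }\ell_2\text{-SVM}]\longrightarrow\begin{cases}0&\text{if } d_n=(2-\varepsilon_n)\,n\ln n,\\ 1&\text{if } d_n=(2+\varepsilon_n)\,n\ln n,\end{cases}$$ where each equality is understood up to rounding: $|d_n-(2\mp\varepsilon_n)n\ln n|<1$ for all sufficiently large $n$. (2) The transition takes place at $d=2n\ln n$ with width $O(n\sqrt{\log n})$: for every $\delta>0$ and all sufficiently large $n$ (depending on $c_1$ and $\delta$), every $d\in\mathbb N$ and every isotropic Gaussian sample of size $n$ in dimension $d$ with fixed labels satisfy $$\Pr[\text{SVP occurs for the }\ell_2\text{-SVM}]\le\delta\quad\text{if } c_1n\ln n\le d\le 2n\ln n-C_2\,n\sqrt{\ln n},$$ $$\Pr[\text{SVP occurs for the }\ell_2\text{-SVM}]\ge1-\delta\quad\text{if } 2n\ln n+C_2\,n\sqrt{\ln n}\le d\le(4-c_1)n\ln n.$$ -/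

import Mathlib

open MeasureTheory ProbabilityTheory Filter Topology

universe u

/-- `(x, y)` is an isotropic Gaussian sample of size `n` in dimension `d` under the law `P`: the
labels `y i` are fixed (non-random) elements of `{-1, 1}`, the `n * d` real coordinates of the
feature vectors are mutually independent, and each `x i` has law `N(0, I_d)`. -/
structure IsIsotropicGaussianSample {n d : ℕ} {Ω : Type*} [MeasurableSpace Ω] (P : Measure Ω)
    (x : Fin n → Ω → EuclideanSpace ℝ (Fin d)) (y : Fin n → ℝ) : Prop where
  label : ∀ i, y i = 1 ∨ y i = -1
  indep : iIndepFun (fun (p : Fin n × Fin d) (ω : Ω) => x p.1 ω p.2) P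
  law : ∀ i, HasLaw (x i) (stdGaussian (EuclideanSpace ℝ (Fin d))) P

/-- The feasible set of the hard-margin SVM problem: `y i * wᵀ (x i) ≥ 1` for all `i`. -/
def svmFeasible {n d : ℕ} (x : Fin n → EuclideanSpace ℝ (Fin d)) (y : Fin n → ℝ) :
    Set (EuclideanSpace ℝ (Fin d)) :=
  {w | ∀ i, 1 ≤ y i * inner ℝ w (x i)}

/-- `w` solves the hard-margin `ℓ₂`-SVM problem: it is feasible and has least Euclidean norm among
all feasible vectors. -/
def IsSVMSolution {n d : ℕ} (x : Fin n → EuclideanSpace ℝ (Fin d)) (y : Fin n → ℝ)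
    (w : EuclideanSpace ℝ (Fin d)) : Prop :=
  w ∈ svmFeasible x y ∧ ∀ v ∈ svmFeasible x y, ‖w‖ ≤ ‖v‖

/-- The example `(x i, y i)` is a support vector for the separator `w`. -/
def IsSupportVector {n d : ℕ} (x : Fin n → EuclideanSpace ℝ (Fin d)) (y : Fin n → ℝ)
    (w : EuclideanSpace ℝ (Fin d)) (i : Fin n) : Prop :=
  y i * inner ℝ w (x i) = 1

/-- Support vector proliferation for the `ℓ₂`-SVM: the SVM problem has a solution (which is then
unique, the norm being strictly convex) and every example is a support vector for it. -/
def SVP {n d : ℕ} (x : Fin n → EuclideanSpace ℝ (Fin d)) (y : Fin n → ℝ) : Prop :=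
  ∃ w, IsSVMSolution x y w ∧ ∀ i, IsSupportVector x y w i

/-! Absorb the labels into the vectors, `z i = y i • x i`; by symmetry these are again i.i.d.
standard Gaussian. Let `v_i` be the least-norm vector with `⟪v_i, z j⟫ = 1` for all `j ≠ i`. Convex
duality gives a leave-one-out criterion: SVP forces `⟪v_i, z i⟫ ≤ 1` for all `i`
(`SVP.inner_le_one`), and strict inequality for all `i` gives SVP for independent vectors
(`svp_of_inner_lt_one`). Since `v_i` is independent of `z i`, the product is conditionally `N(0,
‖v_i‖²)`, and `‖v_i‖² ≈ n / d`: rotating the sample index turns the norm of an interpolator into the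
distance from one Gaussian vector to the span of the others, a chi-square quantity. So a violation
at `i` has probability about `exp(-d / (2n))`, and `n` such events balance at `d = 2n log n`.

Above the threshold a union bound suffices (`gaussianFamily_not_svp_le`). Below it, the products
`⟪v_i, z i⟫` are dependent. Take a set `S` of about `n / log n` indices and let `w` interpolate only
the vectors outside `S`. By Pythagoras `‖v_i - w‖² = ‖v_i‖² - ‖w‖² = O(1 / log² n)` for `i ∈ S`, so
`⟪w, z i⟫` and `⟪v_i, z i⟫` differ by `O(1 / √(log n))` uniformly on `S`. Given `w`, the `⟪w, z i⟫`
with `i ∈ S` are independent, and with high probability one of them exceeds 1 by more than this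
error (`gaussianFamily_svp_le`). The error shifts the exponent by `O(√(log n))`, whence the width `n
√(log n)`. -/

/-! ### Minimum norm interpolation. -/

section Interpolation

variable {E : Type*} [NormedAddCommGroup E] [InnerProductSpace ℝ E] {κ : Type*}

/-- `w` is the vector of least norm with `⟪w, z j⟫ = 1` for all `j`. -/
structure IsMinNormInterpolator (z : κ → E) (w : E) : Prop where
  mem_span : w ∈ Submodule.span ℝ (Set.range z)
  inner_eq : ∀ j, inner ℝ w (z j) = 1

lemma inner_eq_zero_of_mem_span {z : κ → E} {u w : E} (hu : ∀ j, inner ℝ u (z j) = 0)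
    (hw : w ∈ Submodule.span ℝ (Set.range z)) : inner ℝ u w = 0 := by
  induction hw using Submodule.span_induction with
  | mem x hx => obtain ⟨j, rfl⟩ := hx; exact hu j
  | zero => simp
  | add x y _ _ hx hy => rw [inner_add_right, hx, hy, add_zero]
  | smul a x _ hx => rw [inner_smul_right, hx, mul_zero]

/-- Pythagoras for a minimum norm interpolator and another interpolator. -/
lemma IsMinNormInterpolator.norm_sub_sq {z : κ → E} {w v : E} (hw : IsMinNormInterpolator z w)
    (hv : ∀ j, inner ℝ v (z j) = 1) : ‖v - w‖ ^ 2 = ‖v‖ ^ 2 - ‖w‖ ^ 2 := by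
  have h : inner ℝ (v - w) w = 0 := by
    refine inner_eq_zero_of_mem_span (fun j => ?_) hw.mem_span
    rw [inner_sub_left, hv, hw.inner_eq, sub_self]
  rw [inner_sub_left, real_inner_self_eq_norm_sq] at h
  rw [norm_sub_sq_real]
  linarith

/-- The `α j` are the dual variables of the SVM problem; pairing `w = ∑ α j z j` with `w` gives
their sum. -/
lemma IsMinNormInterpolator.exists_sum_eq [Fintype κ] {z : κ → E} {w : E}
    (hw : IsMinNormInterpolator z w) :
    ∃ α : κ → ℝ, ∑ j, α j • z j = w ∧ ∑ j, α j = ‖w‖ ^ 2 := by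
  obtain ⟨α, hα⟩ := (Submodule.mem_span_range_iff_exists_fun ℝ).1 hw.mem_span
  refine ⟨α, hα, ?_⟩
  rw [← real_inner_self_eq_norm_sq]
  nth_rw 2 [← hα]
  simp [inner_sum, inner_smul_right, hw.inner_eq]

lemma IsMinNormInterpolator.ne_zero [Nonempty κ] {z : κ → E} {w : E}
    (hw : IsMinNormInterpolator z w) : w ≠ 0 := by
  rintro rfl
  simpa using hw.inner_eq (Classical.arbitrary κ)

/-- A long interpolator forces the mean to be close to the space of contrasts. -/
lemma IsMinNormInterpolator.exists_norm_sum_lt [Fintype κ] [Nonempty κ] {z : κ → E} {w : E} {r : ℝ}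
    (hw : IsMinNormInterpolator z w) (h : (Fintype.card κ : ℝ) < r * ‖w‖ ^ 2) :
    ∃ c : κ → ℝ, ∑ j, c j * (√(Fintype.card κ))⁻¹ = 1 ∧ ‖∑ j, c j • z j‖ ^ 2 < r := by
  obtain ⟨α, hα, hs⟩ := hw.exists_sum_eq
  have hN : (0 : ℝ) < Fintype.card κ := by exact_mod_cast Fintype.card_pos
  have hw0 : 0 < ‖w‖ := norm_pos_iff.2 hw.ne_zero
  -- With this scaling the combination is `√N • w / ‖w‖²`, of squared norm `N / ‖w‖²`.
  refine ⟨fun j => (√(Fintype.card κ) / ‖w‖ ^ 2) * α j, ?_, ?_⟩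
  · rw [← Finset.sum_mul, ← Finset.mul_sum, hs]
    field_simp
  · simp_rw [mul_smul]
    rw [← Finset.smul_sum, hα, norm_smul, Real.norm_of_nonneg (by positivity), mul_pow, div_pow,
      Real.sq_sqrt hN.le]
    have : (Fintype.card κ : ℝ) / (‖w‖ ^ 2) ^ 2 * ‖w‖ ^ 2 = Fintype.card κ / ‖w‖ ^ 2 := by
      field_simp
    rw [this, div_lt_iff₀ (by positivity)]
    exact h

/-- A short interpolator forces the mean to be long. -/
lemma IsMinNormInterpolator.le_norm_sum_sq [Fintype κ] [Nonempty κ] {z : κ → E} {w : E} {r : ℝ}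
    (hw : IsMinNormInterpolator z w) (h : r * ‖w‖ ^ 2 ≤ (Fintype.card κ : ℝ)) :
    r ≤ ‖∑ j, (√(Fintype.card κ))⁻¹ • z j‖ ^ 2 := by
  have hN : (0 : ℝ) < Fintype.card κ := by exact_mod_cast Fintype.card_pos
  have hw0 : 0 < ‖w‖ := norm_pos_iff.2 hw.ne_zero
  have h1 : inner ℝ w (∑ j, (√(Fintype.card κ))⁻¹ • z j) = √(Fintype.card κ) := by
    simp only [inner_sum, inner_smul_right, hw.inner_eq, mul_one, Finset.sum_const,
      Finset.card_univ, nsmul_eq_mul]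
    rw [← div_eq_mul_inv, Real.div_sqrt]
  have h2 := real_inner_le_norm w (∑ j, (√(Fintype.card κ))⁻¹ • z j)
  rw [h1] at h2
  have h3 : (Fintype.card κ : ℝ) ≤ ‖w‖ ^ 2 * ‖∑ j, (√(Fintype.card κ))⁻¹ • z j‖ ^ 2 := by
    calc (Fintype.card κ : ℝ) = √(Fintype.card κ) ^ 2 := (Real.sq_sqrt hN.le).symm
      _ ≤ (‖w‖ * ‖∑ j, (√(Fintype.card κ))⁻¹ • z j‖) ^ 2 := by gcongr
      _ = _ := mul_pow _ _ _
  have h4 : 0 < ‖w‖ ^ 2 := by positivity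
  by_contra! hlt
  nlinarith

variable [Fintype κ]

open Classical in
/-- The minimum norm interpolator of a linearly independent family. -/
noncomputable def minNormInterpolator (z : κ → E) : E :=
  ∑ j, ((Matrix.gram ℝ z)⁻¹.mulVec 1) j • z j

lemma isMinNormInterpolator_minNormInterpolator {z : κ → E} (hz : LinearIndependent ℝ z) :
    IsMinNormInterpolator z (minNormInterpolator z) := by
  classical
  refine ⟨Submodule.sum_mem _ fun j _ =>
    Submodule.smul_mem _ _ (Submodule.subset_span ⟨j, rfl⟩), fun i => ?_⟩
  have hdet : IsUnit (Matrix.gram ℝ z).det :=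
    isUnit_iff_ne_zero.2 (Matrix.det_gram_ne_zero_iff_linearIndependent.2 hz)
  have h : (Matrix.gram ℝ z).mulVec ((Matrix.gram ℝ z)⁻¹.mulVec 1) = 1 := by
    rw [Matrix.mulVec_mulVec, Matrix.mul_nonsing_inv _ hdet, Matrix.one_mulVec]
  have h1 := congrFun h i
  rw [Matrix.mulVec, dotProduct] at h1
  rw [minNormInterpolator, real_inner_comm, inner_sum]
  simp only [Matrix.gram_apply, Pi.one_apply] at h1
  rw [← h1]
  refine Finset.sum_congr rfl fun j _ => ?_
  rw [inner_smul_right, mul_comm]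

/-- The Gram formula makes sense for dependent families too, so it is a total function, measurable
through the determinant and the adjugate. This lets Fubini condition on an interpolator. -/
lemma measurable_minNormInterpolator [MeasurableSpace E] [BorelSpace E]
    [SecondCountableTopology E] :
    Measurable (minNormInterpolator : (κ → E) → E) := by
  classical
  unfold minNormInterpolator
  refine Finset.measurable_sum _ fun j _ => Measurable.smul ?_ (measurable_pi_apply j)
  simp only [Matrix.mulVec, dotProduct, Matrix.inv_def, Matrix.smul_apply, Pi.one_apply, mul_one,
    Ring.inverse_eq_inv', smul_eq_mul]
  refine Finset.measurable_sum _ fun i _ => ?_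
  have hg : Continuous fun z : κ → E => Matrix.gram ℝ z := by
    refine continuous_matrix fun a b => ?_
    simp only [Matrix.gram_apply]
    fun_prop
  have h1 : Measurable fun z : κ → E => (Matrix.gram ℝ z).det := hg.matrix_det.measurable
  have h2 : Measurable fun z : κ → E => (Matrix.gram ℝ z).adjugate j i :=
    (hg.matrix_adjugate.matrix_elem j i).measurable
  exact h1.inv.mul h2

end Interpolation

/-! ### The leave-one-out criterion for support vector proliferation. -/

section SupportVectors

variable {n d : ℕ}

lemma svp_iff_svp_smul (x : Fin n → EuclideanSpace ℝ (Fin d)) (y : Fin n → ℝ) :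
    SVP x y ↔ SVP (fun i => y i • x i) (fun _ => 1) := by
  simp [SVP, IsSVMSolution, svmFeasible, IsSupportVector, inner_smul_right]

/-- Otherwise `v` is feasible, so the SVM solution `w` is no longer than `v`; as `w` also
interpolates, Pythagoras forces `w = v`, contradicting `⟪w, z i⟫ = 1`. -/
lemma SVP.inner_le_one {z : Fin n → EuclideanSpace ℝ (Fin d)} (h : SVP z fun _ => 1) {i : Fin n}
    {v : EuclideanSpace ℝ (Fin d)}
    (hv : IsMinNormInterpolator (fun j : {j // ¬ j = i} => z j) v) : inner ℝ v (z i) ≤ 1 := by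
  obtain ⟨w, ⟨-, hmin⟩, hs⟩ := h
  simp only [IsSupportVector, one_mul] at hs
  by_contra! hlt
  have hfeas : v ∈ svmFeasible z fun _ => 1 := by
    intro j
    rw [one_mul]
    by_cases hj : j = i
    · rw [hj]; exact hlt.le
    · exact (hv.inner_eq ⟨j, hj⟩).ge
  have h1 := hmin v hfeas
  have h2 := hv.norm_sub_sq (v := w) fun j => hs j
  have h3 : ‖w‖ ^ 2 ≤ ‖v‖ ^ 2 := by gcongr
  have h4 : ‖w - v‖ = 0 := by
    have := sq_nonneg ‖w - v‖
    exact pow_eq_zero_iff (two_ne_zero) |>.1 (by linarith)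
  rw [norm_eq_zero, sub_eq_zero] at h4
  rw [← h4, hs i] at hlt
  exact lt_irrefl _ hlt

/-- The identity `α i * (1 - ⟪v, z i⟫) = ‖w - v‖²` makes every dual variable nonnegative, and
nonnegative dual variables certify optimality of `w` by weak duality. -/
lemma svp_of_inner_lt_one {z : Fin n → EuclideanSpace ℝ (Fin d)} {w : EuclideanSpace ℝ (Fin d)}
    (hw : IsMinNormInterpolator z w)
    (h : ∀ i, ∃ v, IsMinNormInterpolator (fun j : {j // ¬ j = i} => z j) v ∧
      inner ℝ v (z i) < 1) : SVP z fun _ => 1 := by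
  obtain ⟨α, hα, hs⟩ := hw.exists_sum_eq
  have hα0 : ∀ i, 0 ≤ α i := by
    intro i
    obtain ⟨v, hv, hlt⟩ := h i
    have h2 : inner ℝ (w - v) v = 0 := by
      refine inner_eq_zero_of_mem_span (fun j => ?_) hv.mem_span
      rw [inner_sub_left, hv.inner_eq, hw.inner_eq, sub_self]
    -- `w - v` is orthogonal to every `z j` with `j ≠ i`, so only the term `i` survives.
    have h3 : inner ℝ (w - v) w = α i * (1 - inner ℝ v (z i)) := by
      nth_rw 2 [← hα]
      rw [inner_sum, Finset.sum_eq_single i]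
      · rw [inner_smul_right, inner_sub_left, hw.inner_eq]
      · intro j _ hj
        rw [inner_smul_right, inner_sub_left, hw.inner_eq, hv.inner_eq ⟨j, hj⟩]
        simp
      · simp
    have h4 : inner ℝ (w - v) w = ‖w - v‖ ^ 2 := by
      rw [← real_inner_self_eq_norm_sq, inner_sub_right, h2, sub_zero]
    have h5 : 0 ≤ α i * (1 - inner ℝ v (z i)) := by rw [← h3, h4]; positivity
    exact nonneg_of_mul_nonneg_left h5 (by linarith)
  refine ⟨w, ⟨fun i => by simp [hw.inner_eq], fun v hv => ?_⟩,
    fun i => by simp [IsSupportVector, hw.inner_eq]⟩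
  have h1 : ‖w‖ ^ 2 ≤ ‖v‖ * ‖w‖ := by
    calc ‖w‖ ^ 2 = ∑ j, α j * 1 := by simp [hs]
      _ ≤ ∑ j, α j * inner ℝ v (z j) := by
        refine Finset.sum_le_sum fun j _ => mul_le_mul_of_nonneg_left ?_ (hα0 j)
        simpa using hv j
      _ = inner ℝ v w := by simp [← hα, inner_sum, inner_smul_right]
      _ ≤ ‖v‖ * ‖w‖ := real_inner_le_norm _ _
  rcases (norm_nonneg w).eq_or_lt with h0 | h0
  · rw [← h0]; positivity
  · nlinarith

end SupportVectors

/-! ### Chernoff bounds for the squared norm of a Gaussian vector. -/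

section ChiSquare

lemma integrable_exp_mul_sq_gaussianReal {s : ℝ} (hs : s < 1 / 2) :
    Integrable (fun x => Real.exp (s * x ^ 2)) (gaussianReal 0 1) := by
  rw [gaussianReal_of_var_ne_zero _ one_ne_zero,
    integrable_withDensity_iff (measurable_gaussianPDF _ _) (by simp [gaussianPDF])]
  have h : (fun x : ℝ => Real.exp (s * x ^ 2) * (gaussianPDF 0 1 x).toReal) =
      fun x => (√(2 * Real.pi))⁻¹ * Real.exp (-(1 / 2 - s) * x ^ 2) := by
    ext x
    rw [toReal_gaussianPDF, gaussianPDFReal, mul_left_comm, ← Real.exp_add]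
    congr 2
    · simp
    · simp; ring
  rw [h]
  exact (integrable_exp_neg_mul_sq (by linarith)).const_mul _

lemma integral_exp_mul_sq_gaussianReal {s : ℝ} (hs : s < 1 / 2) :
    ∫ x, Real.exp (s * x ^ 2) ∂(gaussianReal 0 1) = (√(1 - 2 * s))⁻¹ := by
  rw [integral_gaussianReal_eq_integral_smul one_ne_zero]
  have h : (fun x : ℝ => gaussianPDFReal 0 1 x • Real.exp (s * x ^ 2)) =
      fun x => (√(2 * Real.pi))⁻¹ * Real.exp (-(1 / 2 - s) * x ^ 2) := by
    ext x
    rw [gaussianPDFReal, smul_eq_mul, mul_assoc, ← Real.exp_add]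
    congr 2
    · simp
    · simp; ring
  rw [h, integral_const_mul, integral_gaussian, ← Real.sqrt_inv, ← Real.sqrt_mul (by positivity),
    ← Real.sqrt_inv]
  congr 1
  have : (1 / 2 - s) ≠ 0 := by linarith
  have h2 : (1 - 2 * s) ≠ 0 := by linarith
  field_simp

/-- `(1 - 2s)^(-1/2) = exp (s + s² + ⋯)`; for small `s` of either sign, `2s²` dominates the tail of
the series. -/
lemma integral_exp_mul_sq_gaussianReal_le {s : ℝ} (hs : |s| ≤ 1 / 6) :
    ∫ x, Real.exp (s * x ^ 2) ∂(gaussianReal 0 1) ≤ Real.exp (s + 2 * s ^ 2) := by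
  obtain ⟨h1, h2⟩ := abs_le.1 hs
  rw [integral_exp_mul_sq_gaussianReal (by linarith)]
  have hpos : 0 < 1 - 2 * s := by linarith
  have key : 1 ≤ (1 - 2 * s) * Real.exp (2 * (s + 2 * s ^ 2)) := by
    rcases le_total s 0 with h0 | h0
    · have := Real.add_one_le_exp (2 * (s + 2 * s ^ 2))
      nlinarith [mul_nonneg (neg_nonneg.2 h0) (sq_nonneg s)]
    · have := Real.quadratic_le_exp_of_nonneg (x := 2 * (s + 2 * s ^ 2)) (by positivity)
      have h3 : 1 + 2 * s + 6 * s ^ 2 ≤ Real.exp (2 * (s + 2 * s ^ 2)) := by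
        nlinarith [pow_nonneg h0 3, pow_nonneg h0 4]
      nlinarith [mul_nonneg h0 (sq_nonneg s), sq_nonneg s]
  have h4 : Real.exp (2 * (s + 2 * s ^ 2)) = Real.exp (s + 2 * s ^ 2) ^ 2 := by
    rw [← Real.exp_nat_mul]; norm_num
  rw [inv_le_comm₀ (by positivity) (by positivity), Real.le_sqrt (by positivity) hpos.le, inv_pow,
    ← h4, inv_le_iff_one_le_mul₀ (by positivity)]
  exact key

lemma exp_mul_norm_sq_sum {F : Type*} [NormedAddCommGroup F] [InnerProductSpace ℝ F]
    [FiniteDimensional ℝ F] (s : ℝ) (x : Fin (Module.finrank ℝ F) → ℝ) :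
    Real.exp (s * ‖∑ i, x i • stdOrthonormalBasis ℝ F i‖ ^ 2) =
      ∏ i, Real.exp (s * x i ^ 2) := by
  rw [← Real.exp_sum, ← Finset.mul_sum, ← (stdOrthonormalBasis ℝ F).sum_sq_inner_left]
  congr 2
  refine Finset.sum_congr rfl fun i _ => ?_
  rw [sum_inner]
  simp [inner_smul_left, OrthonormalBasis.inner_eq_ite]

variable {F : Type*} [NormedAddCommGroup F] [InnerProductSpace ℝ F] [FiniteDimensional ℝ F]
  [MeasurableSpace F] [BorelSpace F]

lemma integrable_exp_mul_norm_sq_stdGaussian {s : ℝ} (hs : s < 1 / 2) :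
    Integrable (fun x : F => Real.exp (s * ‖x‖ ^ 2)) (stdGaussian F) := by
  rw [stdGaussian, integrable_map_measure (Measurable.aestronglyMeasurable (by fun_prop))
    (Measurable.aemeasurable (by fun_prop))]
  simp only [Function.comp_def, exp_mul_norm_sq_sum]
  exact Integrable.fintype_prod fun _ => integrable_exp_mul_sq_gaussianReal hs

lemma integral_exp_mul_norm_sq_stdGaussian_le {s : ℝ} (hs : |s| ≤ 1 / 6) :
    ∫ x : F, Real.exp (s * ‖x‖ ^ 2) ∂(stdGaussian F) ≤
      Real.exp (Module.finrank ℝ F * (s + 2 * s ^ 2)) := by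
  rw [stdGaussian, integral_map (Measurable.aemeasurable (by fun_prop))
    (Measurable.aestronglyMeasurable (by fun_prop))]
  simp only [exp_mul_norm_sq_sum]
  rw [integral_fintype_prod_eq_prod (f := fun _ x => Real.exp (s * x ^ 2)), Real.exp_nat_mul,
    Finset.prod_const, Finset.card_univ, Fintype.card_fin]
  exact pow_le_pow_left₀ (integral_nonneg fun _ => (Real.exp_pos _).le)
    (integral_exp_mul_sq_gaussianReal_le hs) _

lemma stdGaussian_norm_sq_ge_le {η : ℝ} (h0 : 0 ≤ η) (h1 : η ≤ 1 / 2) :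
    stdGaussian F {x | (1 + η) * Module.finrank ℝ F ≤ ‖x‖ ^ 2} ≤
      ENNReal.ofReal (Real.exp (-(Module.finrank ℝ F * η ^ 2 / 8))) := by
  rw [← ofReal_measureReal]
  refine ENNReal.ofReal_le_ofReal ?_
  -- The exponent `-t (1 + η) + t + 2t²` per dimension is minimal at `t = η / 4`, with value `-η² /
  -- 8`.
  refine (measure_ge_le_exp_mul_mgf (X := fun x : F => ‖x‖ ^ 2) (t := η / 4) _ (by positivity)
    (integrable_exp_mul_norm_sq_stdGaussian (by linarith))).trans ?_
  refine (mul_le_mul_of_nonneg_left (integral_exp_mul_norm_sq_stdGaussian_le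
    (by rw [abs_of_nonneg] <;> linarith)) (Real.exp_pos _).le).trans ?_
  rw [← Real.exp_add, Real.exp_le_exp]
  exact le_of_eq (by ring)

lemma stdGaussian_norm_sq_le_le {η : ℝ} (h0 : 0 ≤ η) (h1 : η ≤ 1 / 2) :
    stdGaussian F {x | ‖x‖ ^ 2 ≤ (1 - η) * Module.finrank ℝ F} ≤
      ENNReal.ofReal (Real.exp (-(Module.finrank ℝ F * η ^ 2 / 8))) := by
  rw [← ofReal_measureReal]
  refine ENNReal.ofReal_le_ofReal ?_
  refine (measure_le_le_exp_mul_mgf (X := fun x : F => ‖x‖ ^ 2) (t := -(η / 4)) _ (by linarith)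
    (integrable_exp_mul_norm_sq_stdGaussian (by linarith))).trans ?_
  refine (mul_le_mul_of_nonneg_left (integral_exp_mul_norm_sq_stdGaussian_le
    (by rw [abs_neg, abs_of_nonneg] <;> linarith)) (Real.exp_pos _).le).trans ?_
  rw [← Real.exp_add, Real.exp_le_exp]
  exact le_of_eq (by ring)

end ChiSquare

/-! ### Projections and one-dimensional tails of a Gaussian vector. -/

section StandardGaussian

variable {F : Type*} [NormedAddCommGroup F] [InnerProductSpace ℝ F] [FiniteDimensional ℝ F]
  [MeasurableSpace F] [BorelSpace F]

lemma stdGaussian_map_orthogonalProjection (W : Submodule ℝ F) :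
    (stdGaussian F).map W.orthogonalProjectionOnto = stdGaussian W := by
  apply Measure.ext_of_charFun
  ext t
  rw [charFun_stdGaussian, charFun_apply, integral_map (by fun_prop)
    (Measurable.aestronglyMeasurable (by fun_prop))]
  have h : ∀ x : F, inner ℝ (W.orthogonalProjectionOnto x) t = inner ℝ x (t : F) := fun x => by
    rw [Submodule.inner_orthogonalProjectionOnto_eq_of_mem_right]
  simp_rw [h]
  rw [← charFun_apply, charFun_stdGaussian]
  simp

/-- The distance from a standard Gaussian vector to a subspace is rarely small. -/
lemma stdGaussian_exists_norm_add_sq_lt_le (V : Submodule ℝ F) {η : ℝ} (h0 : 0 ≤ η) (h1 : η ≤ 1 / 2)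
    {k : ℕ} (hk : Module.finrank ℝ V + k ≤ Module.finrank ℝ F) :
    stdGaussian F {x | ∃ v ∈ V, ‖x + v‖ ^ 2 < (1 - η) * k} ≤
      ENNReal.ofReal (Real.exp (-(k * η ^ 2 / 8))) := by
  have hfin := V.finrank_add_finrank_orthogonal
  have hk' : (k : ℝ) ≤ Module.finrank ℝ Vᗮ := by exact_mod_cast (by omega : k ≤ _)
  -- Adding `v ∈ V` does not change the component in `Vᗮ`, which is a standard Gaussian vector in
  -- dimension at least `k`.
  have hsub : {x : F | ∃ v ∈ V, ‖x + v‖ ^ 2 < (1 - η) * k} ⊆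
      Vᗮ.orthogonalProjectionOnto ⁻¹' {y | ‖y‖ ^ 2 ≤ (1 - η) * Module.finrank ℝ Vᗮ} := by
    rintro x ⟨v, hv, hlt⟩
    have h2 : Vᗮ.orthogonalProjectionOnto x = Vᗮ.orthogonalProjectionOnto (x + v) := by
      rw [map_add, Submodule.orthogonalProjectionOnto_apply_of_mem_orthogonal
        (K := Vᗮ) (v := v) (by rwa [Submodule.orthogonal_orthogonal]), add_zero]
    have h3 : ‖Vᗮ.orthogonalProjectionOnto (x + v)‖ ≤ ‖x + v‖ :=
      Submodule.norm_orthogonalProjectionOnto_apply_le _ _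
    simp only [Set.mem_preimage, Set.mem_ofPred_eq]
    calc ‖Vᗮ.orthogonalProjectionOnto x‖ ^ 2 ≤ ‖x + v‖ ^ 2 := by rw [h2]; gcongr
      _ ≤ (1 - η) * k := hlt.le
      _ ≤ _ := by gcongr; linarith
  refine (measure_mono hsub).trans ((Measure.le_map_apply (by fun_prop) _).trans ?_)
  rw [stdGaussian_map_orthogonalProjection]
  refine (stdGaussian_norm_sq_le_le h0 h1).trans (ENNReal.ofReal_le_ofReal ?_)
  gcongr

lemma stdGaussian_map_inner (w : F) :
    (stdGaussian F).map (fun x => inner ℝ w x) = gaussianReal 0 (‖w‖₊ ^ 2) := by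
  have h := IsGaussian.map_eq_gaussianReal (μ := stdGaussian F) (innerSL ℝ w)
  rw [integral_strongDual_stdGaussian, variance_dual_stdGaussian, innerSL_apply_norm] at h
  rw [Real.toNNReal_pow (norm_nonneg _), norm_toNNReal] at h
  exact h

lemma stdGaussian_le_inner_le {w : F} {t ρ : ℝ} (ht : 0 < t) (hw : ‖w‖ ≤ ρ) :
    stdGaussian F {x | t ≤ inner ℝ w x} ≤ ENNReal.ofReal (Real.exp (-(t ^ 2 / (2 * ρ ^ 2)))) := by
  rcases eq_or_ne w 0 with rfl | hw0
  · simp [not_le.2 ht]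
  have hpos : 0 < ‖w‖ := norm_pos_iff.2 hw0
  rw [← ofReal_measureReal]
  refine ENNReal.ofReal_le_ofReal ?_
  have hmap := stdGaussian_map_inner w
  refine (measure_ge_le_exp_mul_mgf (X := fun x : F => inner ℝ w x) (t := t / ‖w‖ ^ 2) _
    (by positivity) ?_).trans ?_
  · have := integrable_exp_mul_gaussianReal (μ := 0) (v := ‖w‖₊ ^ 2) (t / ‖w‖ ^ 2)
    rw [← hmap, integrable_map_measure (Measurable.aestronglyMeasurable (by fun_prop))
      (by fun_prop)] at this
    exact this
  · rw [mgf_gaussianReal hmap, ← Real.exp_add, Real.exp_le_exp]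
    have h1 : -(t / ‖w‖ ^ 2) * t + (0 * (t / ‖w‖ ^ 2) +
        ((‖w‖₊ ^ 2 : NNReal) : ℝ) * (t / ‖w‖ ^ 2) ^ 2 / 2) = -(t ^ 2 / (2 * ‖w‖ ^ 2)) := by
      push_cast
      field_simp
      ring
    rw [h1, neg_le_neg_iff]
    gcongr

/-- The density on `(a, a + 1]` is at least its value at `a + 1`, and `√(2π) ≤ 3`. Replacing `a` by
`a + 1` costs `O(a)` in the exponent, here `O(√(log n))`, which the transition width absorbs. -/
lemma gaussianReal_Ioi_ge {a : ℝ} (ha : 0 ≤ a) :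
    Real.exp (-((a + 1) ^ 2 / 2)) / 3 ≤ (gaussianReal 0 1).real (Set.Ioi a) := by
  rw [measureReal_def, gaussianReal_apply_eq_integral _ one_ne_zero, ENNReal.toReal_ofReal
    (integral_nonneg fun _ => gaussianPDFReal_nonneg _ _ _)]
  have h1 : ∫ x in Set.Ioc a (a + 1), Real.exp (-((a + 1) ^ 2 / 2)) / 3 =
      Real.exp (-((a + 1) ^ 2 / 2)) / 3 := by simp
  rw [← h1]
  calc ∫ x in Set.Ioc a (a + 1), Real.exp (-((a + 1) ^ 2 / 2)) / 3
      ≤ ∫ x in Set.Ioc a (a + 1), gaussianPDFReal 0 1 x := by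
        refine setIntegral_mono_on (by simp) (integrable_gaussianPDFReal _ _).integrableOn
          measurableSet_Ioc fun x hx => ?_
        rw [gaussianPDFReal, mul_comm _ (Real.exp _), div_eq_mul_inv]
        have hpi : √(2 * Real.pi) ≤ 3 := by
          rw [Real.sqrt_le_left (by norm_num)]
          linarith [Real.pi_lt_d2]
        have hx0 : 0 ≤ x := ha.trans hx.1.le
        simp only [NNReal.coe_one, mul_one, sub_zero]
        refine mul_le_mul ?_ (inv_anti₀ (by positivity) hpi) (by norm_num) (Real.exp_pos _).le
        rw [Real.exp_le_exp, neg_div, neg_le_neg_iff]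
        gcongr
        exact hx.2
    _ ≤ ∫ x in Set.Ioi a, gaussianPDFReal 0 1 x :=
        setIntegral_mono_set (integrable_gaussianPDFReal _ _).integrableOn
          (ae_of_all _ fun _ => gaussianPDFReal_nonneg _ _ _)
          (Set.Ioc_subset_Ioi_self.eventuallyLE)

lemma stdGaussian_inner_le_le {w : F} {t σ : ℝ} (ht : 0 ≤ t) (hσ : 0 < σ) (hw : σ ≤ ‖w‖) :
    stdGaussian F {x | inner ℝ w x ≤ t} ≤
      ENNReal.ofReal (1 - Real.exp (-((t / σ + 1) ^ 2 / 2)) / 3) := by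
  have hpos : 0 < ‖w‖ := hσ.trans_le hw
  have hmap : (stdGaussian F).map (fun x => inner ℝ (‖w‖⁻¹ • w) x) = gaussianReal 0 1 := by
    rw [stdGaussian_map_inner]
    congr 1
    ext
    simp [norm_smul, hpos.ne']
  have hset : {x : F | inner ℝ w x ≤ t} =
      ((fun x => inner ℝ (‖w‖⁻¹ • w) x) ⁻¹' (Set.Ioi (t / ‖w‖)))ᶜ := by
    ext x
    simp only [Set.mem_ofPred_eq, Set.mem_compl_iff, Set.mem_preimage, Set.mem_Ioi, not_lt,
      inner_smul_left, conj_trivial]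
    rw [inv_mul_eq_div, div_le_div_iff_of_pos_right hpos]
  rw [← ofReal_measureReal]
  refine ENNReal.ofReal_le_ofReal ?_
  have hm : Measurable (fun x : F => inner ℝ (‖w‖⁻¹ • w) x) := by fun_prop
  rw [hset, probReal_compl_eq_one_sub (hm measurableSet_Ioi), ← map_measureReal_apply hm
    measurableSet_Ioi, hmap]
  refine sub_le_sub_left ((?_ : _ ≤ _).trans (gaussianReal_Ioi_ge (by positivity))) _
  gcongr

end StandardGaussian

/-! ### Independent Gaussian vectors: conditioning and rotation of the sample index. -/

section GaussianFamily

variable {κ : Type*} [Fintype κ]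

/-- The law of a family of independent standard Gaussian vectors. -/
noncomputable abbrev gaussianFamily (κ : Type*) [Fintype κ] (F : Type*) [NormedAddCommGroup F]
    [InnerProductSpace ℝ F] [FiniteDimensional ℝ F] [MeasurableSpace F] [BorelSpace F] :
    Measure (κ → F) :=
  Measure.pi fun _ => stdGaussian F

section Split

variable {F : Type*} [NormedAddCommGroup F] [InnerProductSpace ℝ F] [FiniteDimensional ℝ F]
  [MeasurableSpace F] [BorelSpace F]

lemma measurePreserving_eval_restrict [DecidableEq κ] (i : κ) :
    MeasurePreserving (fun z : κ → F => (z i, fun j : {j // ¬ j = i} => z j))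
      (gaussianFamily κ F) ((stdGaussian F).prod (gaussianFamily {j // ¬ j = i} F)) := by
  have h1 : MeasurePreserving (MeasurableEquiv.piEquivPiSubtypeProd (fun _ : κ => F) (· = i))
      (gaussianFamily κ F)
      ((gaussianFamily {j // j = i} F).prod (gaussianFamily {j // ¬ j = i} F)) := by
    convert measurePreserving_piEquivPiSubtypeProd (fun _ : κ => stdGaussian F) (· = i)
  have h2 := measurePreserving_piUnique (fun _ : {j // j = i} => stdGaussian F)
  exact (h2.prod (MeasurePreserving.id (gaussianFamily {j // ¬ j = i} F))).comp h1

lemma measurePreserving_restrict (p : κ → Prop) [DecidablePred p] :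
    MeasurePreserving (fun z : κ → F => fun j : {j // ¬ p j} => z j)
      (gaussianFamily κ F) (gaussianFamily {j // ¬ p j} F) :=
  measurePreserving_snd.comp
    (measurePreserving_piEquivPiSubtypeProd (fun _ : κ => stdGaussian F) p)

lemma prod_le_of_forall_slice_le {α β : Type*} [MeasurableSpace α] [MeasurableSpace β]
    {μ : Measure α} {ν : Measure β} [IsProbabilityMeasure μ] [IsProbabilityMeasure ν]
    {s : Set (α × β)} (hs : MeasurableSet s) {b : ENNReal}
    (h : ∀ y, μ {x | (x, y) ∈ s} ≤ b) : μ.prod ν s ≤ b := by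
  rw [Measure.prod_apply_symm hs]
  calc ∫⁻ y, μ ((fun x => (x, y)) ⁻¹' s) ∂ν ≤ ∫⁻ _, b ∂ν := lintegral_mono fun y => h y
    _ = b := by simp

/-- Tail bound for the inner product with a vector depending on the other vectors only. -/
lemma gaussianFamily_le_inner_le [DecidableEq κ] (i : κ) {V : ({j // ¬ j = i} → F) → F}
    (hV : Measurable V) {t ρ : ℝ} (ht : 0 < t) :
    gaussianFamily κ F {z | ‖V fun j => z j‖ ≤ ρ ∧ t ≤ inner ℝ (V fun j => z j) (z i)} ≤
      ENNReal.ofReal (Real.exp (-(t ^ 2 / (2 * ρ ^ 2)))) := by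
  have hs : MeasurableSet {q : F × ({j // ¬ j = i} → F) |
      ‖V q.2‖ ≤ ρ ∧ t ≤ inner ℝ (V q.2) q.1} := by
    have h1 : MeasurableSet {q : F × ({j // ¬ j = i} → F) | ‖V q.2‖ ≤ ρ} :=
      measurableSet_le (by fun_prop) (by fun_prop)
    have h2 : MeasurableSet {q : F × ({j // ¬ j = i} → F) | t ≤ inner ℝ (V q.2) q.1} :=
      measurableSet_le (by fun_prop) ((hV.comp measurable_snd).inner measurable_fst)
    exact h1.inter h2
  refine ((measurePreserving_eval_restrict (F := F) i).measure_preimage hs.nullMeasurableSet).trans_le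
    (prod_le_of_forall_slice_le hs fun y => ?_)
  by_cases hy : ‖V y‖ ≤ ρ
  · refine (measure_mono fun x hx => ?_).trans (stdGaussian_le_inner_le ht hy)
    exact hx.2
  · have : {x : F | (x, y) ∈ {q : F × ({j // ¬ j = i} → F) |
        ‖V q.2‖ ≤ ρ ∧ t ≤ inner ℝ (V q.2) q.1}} = ∅ := by
      ext x; simp [hy]
    rw [this]; simp

/-- Anti-concentration for the maximum of the inner products with an independent vector. -/
lemma gaussianFamily_forall_inner_le_le (S : Finset κ) [DecidableEq κ]
    {W : ({j // ¬ j ∈ S} → F) → F} (hW : Measurable W) {t σ : ℝ} (ht : 0 ≤ t) (hσ : 0 < σ) :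
    gaussianFamily κ F {z | σ ≤ ‖W fun j => z j‖ ∧ ∀ i ∈ S, inner ℝ (W fun j => z j) (z i) ≤ t} ≤
      ENNReal.ofReal (1 - Real.exp (-((t / σ + 1) ^ 2 / 2)) / 3) ^ S.card := by
  have hs : MeasurableSet {q : ({j // j ∈ S} → F) × ({j // ¬ j ∈ S} → F) |
      σ ≤ ‖W q.2‖ ∧ ∀ i, inner ℝ (W q.2) (q.1 i) ≤ t} := by
    have h1 : MeasurableSet {q : ({j // j ∈ S} → F) × ({j // ¬ j ∈ S} → F) | σ ≤ ‖W q.2‖} :=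
      measurableSet_le (by fun_prop) (by fun_prop)
    have h2 (i : {j // j ∈ S}) : MeasurableSet
        {q : ({j // j ∈ S} → F) × ({j // ¬ j ∈ S} → F) | inner ℝ (W q.2) (q.1 i) ≤ t} :=
      measurableSet_le ((hW.comp measurable_snd).inner ((measurable_pi_apply i).comp measurable_fst))
        (by fun_prop)
    convert h1.inter (MeasurableSet.iInter h2) using 1
    ext q
    simp
  have hpre : {z : κ → F | σ ≤ ‖W fun j => z j‖ ∧ ∀ i ∈ S, inner ℝ (W fun j => z j) (z i) ≤ t} =
      MeasurableEquiv.piEquivPiSubtypeProd (fun _ : κ => F) (· ∈ S) ⁻¹'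
        {q | σ ≤ ‖W q.2‖ ∧ ∀ i, inner ℝ (W q.2) (q.1 i) ≤ t} := by
    ext z
    simp only [Set.mem_ofPred_eq, Set.mem_preimage, Subtype.forall]
    rfl
  have hmp : MeasurePreserving (MeasurableEquiv.piEquivPiSubtypeProd (fun _ : κ => F) (· ∈ S))
      (gaussianFamily κ F)
      ((gaussianFamily {j // j ∈ S} F).prod (gaussianFamily {j // ¬ j ∈ S} F)) := by
    convert measurePreserving_piEquivPiSubtypeProd (fun _ : κ => stdGaussian F) (· ∈ S)
  rw [hpre]
  refine (hmp.measure_preimage hs.nullMeasurableSet).trans_le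
    (prod_le_of_forall_slice_le hs fun y => ?_)
  by_cases hy : σ ≤ ‖W y‖
  · have h1 : {x : {j // j ∈ S} → F | (x, y) ∈ {q : ({j // j ∈ S} → F) × ({j // ¬ j ∈ S} → F) |
        σ ≤ ‖W q.2‖ ∧ ∀ i, inner ℝ (W q.2) (q.1 i) ≤ t}} =
        Set.univ.pi fun _ => {x : F | inner ℝ (W y) x ≤ t} := by
      ext x; simp [hy]
    rw [h1, Measure.pi_pi, Finset.prod_const, Finset.card_univ, Fintype.card_coe]
    exact pow_le_pow_left' (stdGaussian_inner_le_le ht hσ hy) _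
  · have : {x : {j // j ∈ S} → F | (x, y) ∈ {q : ({j // j ∈ S} → F) × ({j // ¬ j ∈ S} → F) |
        σ ≤ ‖W q.2‖ ∧ ∀ i, inner ℝ (W q.2) (q.1 i) ≤ t}} = ∅ := by
      ext x; simp [hy]
    rw [this]; simp

/-- The distance from one vector of the family to the span of the others is rarely small. -/
lemma gaussianFamily_exists_norm_sum_lt_le [DecidableEq κ] (i : κ) {η : ℝ} (h0 : 0 ≤ η)
    (h1 : η ≤ 1 / 2) {k : ℕ} (hk : Fintype.card κ + k ≤ Module.finrank ℝ F + 1) :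
    gaussianFamily κ F {z | ∃ c : κ → ℝ, c i = 1 ∧ ‖∑ j, c j • z j‖ ^ 2 < (1 - η) * k} ≤
      ENNReal.ofReal (Real.exp (-(k * η ^ 2 / 8))) := by
  -- Openness supplies measurability despite the uncountable union over `c`.
  have hs : IsOpen {q : F × ({j // ¬ j = i} → F) |
      ∃ c : {j // ¬ j = i} → ℝ, ‖q.1 + ∑ j, c j • q.2 j‖ ^ 2 < (1 - η) * k} := by
    rw [Set.ofPred_exists]
    exact isOpen_iUnion fun c => isOpen_lt (by fun_prop) (by fun_prop)
  have hsub : {z : κ → F | ∃ c : κ → ℝ, c i = 1 ∧ ‖∑ j, c j • z j‖ ^ 2 < (1 - η) * k} ⊆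
      (fun z : κ → F => (z i, fun j : {j // ¬ j = i} => z j)) ⁻¹' {q |
        ∃ c : {j // ¬ j = i} → ℝ, ‖q.1 + ∑ j, c j • q.2 j‖ ^ 2 < (1 - η) * k} := by
    rintro z ⟨c, hc, hlt⟩
    refine ⟨fun j => c j, ?_⟩
    have h : ∑ j, c j • z j = z i + ∑ j : {j // ¬ j = i}, c j • z j := by
      rw [Fintype.sum_eq_add_sum_subtype_ne _ i, hc, one_smul]
    rwa [h] at hlt
  refine (measure_mono hsub).trans
    (((measurePreserving_eval_restrict (F := F) i).measure_preimage
      hs.measurableSet.nullMeasurableSet).trans_le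
      (prod_le_of_forall_slice_le hs.measurableSet fun y => ?_))
  have hcard : Fintype.card {j // ¬ j = i} + 1 = Fintype.card κ := by
    rw [Fintype.card_subtype_compl, Fintype.card_subtype_eq]
    have := Fintype.card_pos_iff.2 ⟨i⟩
    omega
  have hV := finrank_range_le_card (R := ℝ) y
  refine (measure_mono ?_).trans (stdGaussian_exists_norm_add_sq_lt_le
    (Submodule.span ℝ (Set.range y)) h0 h1 (k := k) ?_)
  · rintro x ⟨c, hc⟩
    exact ⟨_, Submodule.sum_mem _ fun j _ => Submodule.smul_mem _ _ (Submodule.subset_span ⟨j, rfl⟩),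
      hc⟩
  · rw [Set.finrank] at hV
    omega

/-- A linear relation, normalised at a nonzero coefficient, puts one vector at distance 0 from the
span of the others; a crude union bound is enough here. -/
lemma gaussianFamily_not_linearIndependent_le [DecidableEq κ] {k : ℕ} (hk0 : 0 < k)
    (hk : Fintype.card κ + k ≤ Module.finrank ℝ F + 1) :
    gaussianFamily κ F {z | ¬ LinearIndependent ℝ z} ≤
      Fintype.card κ * ENNReal.ofReal (Real.exp (-(k / 32 : ℝ))) := by
  have hsub : {z : κ → F | ¬ LinearIndependent ℝ z} ⊆ ⋃ i : κ,
      {z | ∃ c : κ → ℝ, c i = 1 ∧ ‖∑ j, c j • z j‖ ^ 2 < (1 - 1 / 2) * k} := by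
    intro z hz
    obtain ⟨g, hg, i, hi⟩ := Fintype.not_linearIndependent_iff.1 hz
    refine Set.mem_iUnion.2 ⟨i, fun j => (g i)⁻¹ * g j, inv_mul_cancel₀ hi, ?_⟩
    simp_rw [mul_smul]
    rw [← Finset.smul_sum, hg]
    have : (0 : ℝ) < k := by exact_mod_cast hk0
    rw [smul_zero, norm_zero]
    linarith
  refine (measure_mono hsub).trans ((measure_iUnion_fintype_le _ _).trans ?_)
  refine (Finset.sum_le_card_nsmul _ _ (ENNReal.ofReal (Real.exp (-(k / 32 : ℝ))))
    fun i _ => ?_).trans ?_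
  · refine (gaussianFamily_exists_norm_sum_lt_le (F := F) i (η := 1 / 2) (by norm_num) le_rfl
      hk).trans_eq ?_
    rw [show (k : ℝ) * (1 / 2) ^ 2 / 8 = k / 32 by ring]
  · rw [nsmul_eq_mul, Finset.card_univ]

end Split

section Rotation

variable {d : ℕ}

/-- The action of a linear isometry of `ℝ^κ` on families of vectors indexed by `κ`. -/
noncomputable def rotateFamily (R : EuclideanSpace ℝ κ →ₗᵢ[ℝ] EuclideanSpace ℝ κ)
    (z : κ → EuclideanSpace ℝ (Fin d)) : κ → EuclideanSpace ℝ (Fin d) :=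
  fun k => WithLp.toLp 2 fun a => R (WithLp.toLp 2 fun j => z j a) k

lemma map_toLp_gaussianFamily {F : Type*} [NormedAddCommGroup F] [InnerProductSpace ℝ F]
    [FiniteDimensional ℝ F] [MeasurableSpace F] [BorelSpace F] :
    (gaussianFamily κ F).map (WithLp.toLp 2) = stdGaussian (PiLp 2 fun _ : κ => F) := by
  apply Measure.ext_of_charFun
  ext t
  simp_rw [charFun_stdGaussian, charFun_pi, charFun_stdGaussian, ← Complex.exp_sum,
    ← Complex.ofReal_pow, PiLp.norm_sq_eq_of_L2]
  simp [Finset.sum_div, neg_div]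

lemma sum_smul_rotateFamily (R : EuclideanSpace ℝ κ →ₗᵢ[ℝ] EuclideanSpace ℝ κ)
    (z : κ → EuclideanSpace ℝ (Fin d)) (c : EuclideanSpace ℝ κ) :
    ∑ k, R c k • rotateFamily R z k = ∑ k, c k • z k := by
  ext a
  have h := R.inner_map_map (WithLp.toLp 2 fun j => z j a) c
  rw [PiLp.inner_apply, PiLp.inner_apply] at h
  simpa [rotateFamily] using h

/-- The family is one standard Gaussian vector in the `ℓ²` product, on which `R`, applied separately
to each of the `d` coordinates, acts as a linear isometry. -/
lemma measurePreserving_rotateFamily (R : EuclideanSpace ℝ κ →ₗᵢ[ℝ] EuclideanSpace ℝ κ) :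
    MeasurePreserving (rotateFamily R) (gaussianFamily κ (EuclideanSpace ℝ (Fin d)))
      (gaussianFamily κ (EuclideanSpace ℝ (Fin d))) := by
  let L : (PiLp 2 fun _ : κ => EuclideanSpace ℝ (Fin d)) →ₗᵢ[ℝ]
      (PiLp 2 fun _ : κ => EuclideanSpace ℝ (Fin d)) :=
    { toFun := fun z => WithLp.toLp 2 (rotateFamily R z.ofLp)
      map_add' := fun x y => by
        ext k a
        have : (WithLp.toLp 2 fun j => (x + y) j a : EuclideanSpace ℝ κ) =
          WithLp.toLp 2 (fun j => x j a) + WithLp.toLp 2 fun j => y j a := rfl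
        simp only [rotateFamily, PiLp.add_apply]
        change R (WithLp.toLp 2 fun j => (x + y) j a) k = _
        rw [this, map_add]
        rfl
      map_smul' := fun b x => by
        ext k a
        have : (WithLp.toLp 2 fun j => (b • x) j a : EuclideanSpace ℝ κ) =
          b • WithLp.toLp 2 (fun j => x j a) := rfl
        simp only [rotateFamily]
        change R (WithLp.toLp 2 fun j => (b • x) j a) k = _
        rw [this, map_smul]
        rfl
      norm_map' := fun x => by
        rw [← sq_eq_sq₀ (norm_nonneg _) (norm_nonneg _)]
        change ‖(WithLp.toLp 2 (rotateFamily R x.ofLp) :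
          PiLp 2 fun _ : κ => EuclideanSpace ℝ (Fin d))‖ ^ 2 = _
        simp only [PiLp.norm_sq_eq_of_L2, rotateFamily]
        rw [Finset.sum_comm, Finset.sum_comm (s := Finset.univ (α := κ))]
        refine Finset.sum_congr rfl fun a _ => ?_
        have h := R.norm_map (WithLp.toLp 2 fun j => x j a)
        rw [← sq_eq_sq₀ (norm_nonneg _) (norm_nonneg _)] at h
        simpa only [PiLp.norm_sq_eq_of_L2] using h }
  have hL : rotateFamily R = WithLp.ofLp ∘ L.toLinearIsometryEquiv rfl ∘
    (WithLp.toLp 2 : (κ → EuclideanSpace ℝ (Fin d)) → _) := rfl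
  have hmeas : Measurable (rotateFamily R : (κ → EuclideanSpace ℝ (Fin d)) → _) := by
    rw [hL]
    fun_prop
  refine ⟨hmeas, ?_⟩
  rw [hL, ← Measure.map_map (by fun_prop) (by fun_prop), ← Measure.map_map (by fun_prop)
    (by fun_prop), map_toLp_gaussianFamily, stdGaussian_map, ← map_toLp_gaussianFamily,
    Measure.map_map (by fun_prop) (by fun_prop)]
  exact Measure.map_id

/-- The reflection in the hyperplane orthogonal to `u - e_i`. -/
lemma exists_linearIsometry_swap [DecidableEq κ] (i : κ) {u : EuclideanSpace ℝ κ} (hu : ‖u‖ = 1) :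
    ∃ R : EuclideanSpace ℝ κ →ₗᵢ[ℝ] EuclideanSpace ℝ κ,
      R u = EuclideanSpace.single i 1 ∧ R (EuclideanSpace.single i 1) = u := by
  have h : ‖u‖ = ‖(EuclideanSpace.single i 1 : EuclideanSpace ℝ κ)‖ := by simp [hu]
  have h1 := Submodule.reflection_sub h
  have h2 := Submodule.reflection_reflection (ℝ ∙ (u - EuclideanSpace.single i 1))ᗮ u
  generalize (ℝ ∙ (u - EuclideanSpace.single i (1 : ℝ)))ᗮ.reflection = R at h1 h2
  rw [h1] at h2
  exact ⟨R.toLinearIsometry, h1, h2⟩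

/-- Rotating `u` to `e_i` turns the constraint into `c i = 1`, that is, into the distance from one
vector to the span of the others. -/
lemma gaussianFamily_exists_norm_sum_lt_le_of_unit [Nonempty κ] {u : EuclideanSpace ℝ κ}
    (hu : ‖u‖ = 1) {η : ℝ} (h0 : 0 ≤ η) (h1 : η ≤ 1 / 2) {k : ℕ}
    (hk : Fintype.card κ + k ≤ d + 1) :
    gaussianFamily κ (EuclideanSpace ℝ (Fin d))
      {z | ∃ c : κ → ℝ, ∑ j, c j * u j = 1 ∧ ‖∑ j, c j • z j‖ ^ 2 < (1 - η) * k} ≤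
      ENNReal.ofReal (Real.exp (-(k * η ^ 2 / 8))) := by
  classical
  let i : κ := Classical.arbitrary κ
  obtain ⟨R, hR1, hR2⟩ := exists_linearIsometry_swap i hu
  refine (measure_mono fun z hz => ?_).trans
    (((Measure.le_map_apply (measurePreserving_rotateFamily R).measurable.aemeasurable _).trans_eq
      (by rw [(measurePreserving_rotateFamily R).map_eq])).trans
      (gaussianFamily_exists_norm_sum_lt_le (F := EuclideanSpace ℝ (Fin d)) i h0 h1 (k := k)
        (by simpa using hk)))
  obtain ⟨c, hc, hlt⟩ := hz
  refine ⟨fun j => R (WithLp.toLp 2 c) j, ?_, ?_⟩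
  · have h' := R.inner_map_map u (WithLp.toLp 2 c)
    rw [hR1] at h'
    simp only [EuclideanSpace.inner_single_left, map_one, one_mul] at h'
    change R (WithLp.toLp 2 c) i = 1
    rw [h', PiLp.inner_apply, ← hc]
    simp
  · rw [sum_smul_rotateFamily]
    exact hlt

lemma gaussianFamily_le_norm_sum_le_of_unit [Nonempty κ] {u : EuclideanSpace ℝ κ}
    (hu : ‖u‖ = 1) {η : ℝ} (h0 : 0 ≤ η) (h1 : η ≤ 1 / 2) :
    gaussianFamily κ (EuclideanSpace ℝ (Fin d)) {z | (1 + η) * d ≤ ‖∑ j, u j • z j‖ ^ 2} ≤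
      ENNReal.ofReal (Real.exp (-(d * η ^ 2 / 8))) := by
  classical
  let i : κ := Classical.arbitrary κ
  obtain ⟨R, hR1, hR2⟩ := exists_linearIsometry_swap i hu
  have h2 := stdGaussian_norm_sq_ge_le (F := EuclideanSpace ℝ (Fin d)) h0 h1
  rw [finrank_euclideanSpace_fin] at h2
  have hp := (measurePreserving_eval (fun _ : κ => stdGaussian (EuclideanSpace ℝ (Fin d))) i).comp
    (measurePreserving_rotateFamily R)
  refine (measure_mono fun z hz => ?_).trans
    (((Measure.le_map_apply hp.measurable.aemeasurable _).trans_eq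
      (by rw [hp.map_eq])).trans h2)
  have h3 := sum_smul_rotateFamily R z u
  rw [hR1, Finset.sum_eq_single i (by simp +contextual) (by simp)] at h3
  simp only [PiLp.single_apply, if_true, one_smul] at h3
  simpa [← h3] using hz

lemma norm_toLp_inv_sqrt_card [Nonempty κ] :
    ‖(WithLp.toLp 2 fun _ => (√(Fintype.card κ))⁻¹ : EuclideanSpace ℝ κ)‖ = 1 := by
  have hN : (0 : ℝ) < Fintype.card κ := by exact_mod_cast Fintype.card_pos
  rw [EuclideanSpace.norm_eq, Real.sqrt_eq_one]
  simp [hN.ne']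

/-- The minimum norm interpolator is rarely long. -/
lemma gaussianFamily_lt_norm_interpolator_le [Nonempty κ] {η : ℝ} (h0 : 0 ≤ η) (h1 : η ≤ 1 / 2)
    {k : ℕ} (hk : Fintype.card κ + k ≤ d + 1) :
    gaussianFamily κ (EuclideanSpace ℝ (Fin d)) {z | ∃ w, IsMinNormInterpolator z w ∧
      (Fintype.card κ : ℝ) < (1 - η) * k * ‖w‖ ^ 2} ≤
      ENNReal.ofReal (Real.exp (-(k * η ^ 2 / 8))) := by
  refine (measure_mono ?_).trans (gaussianFamily_exists_norm_sum_lt_le_of_unit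
    norm_toLp_inv_sqrt_card h0 h1 hk)
  rintro z ⟨w, hw, hlt⟩
  exact hw.exists_norm_sum_lt hlt

/-- The minimum norm interpolator is rarely short. -/
lemma gaussianFamily_norm_interpolator_le_le [Nonempty κ] {η : ℝ} (h0 : 0 ≤ η) (h1 : η ≤ 1 / 2) :
    gaussianFamily κ (EuclideanSpace ℝ (Fin d)) {z | ∃ w, IsMinNormInterpolator z w ∧
      (1 + η) * d * ‖w‖ ^ 2 ≤ (Fintype.card κ : ℝ)} ≤
      ENNReal.ofReal (Real.exp (-(d * η ^ 2 / 8))) := by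
  refine (measure_mono ?_).trans (gaussianFamily_le_norm_sum_le_of_unit
    norm_toLp_inv_sqrt_card h0 h1)
  rintro z ⟨w, hw, hle⟩
  exact hw.le_norm_sum_sq hle

end Rotation

end GaussianFamily

/-! ### Non-asymptotic bounds on both sides of the transition. -/

section FiniteSampleBounds

variable {n d : ℕ}

lemma measureReal_le_of_le_ofReal {α : Type*} [MeasurableSpace α] {μ : Measure α} {s : Set α}
    {b : ℝ} (hb : 0 ≤ b) (h : μ s ≤ ENNReal.ofReal b) : μ.real s ≤ b :=
  ENNReal.toReal_le_of_le_ofReal hb h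

lemma gaussianFamily_preimage_restrict_le {κ : Type*} [Fintype κ] (p : κ → Prop) [DecidablePred p]
    {F : Type*} [NormedAddCommGroup F] [InnerProductSpace ℝ F] [FiniteDimensional ℝ F]
    [MeasurableSpace F] [BorelSpace F] (s : Set ({j // ¬ p j} → F)) :
    gaussianFamily κ F ((fun z : κ → F => fun j : {j // ¬ p j} => z j) ⁻¹' s) ≤
      gaussianFamily {j // ¬ p j} F s := by
  have h := measurePreserving_restrict (F := F) p
  exact (Measure.le_map_apply h.measurable.aemeasurable _).trans_eq (by rw [h.map_eq])

lemma card_subtype_ne (i : Fin n) : Fintype.card {j // ¬ j = i} = n - 1 := by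
  rw [Fintype.card_subtype_compl, Fintype.card_subtype_eq, Fintype.card_fin]

/-- Leave-one-out interpolators are rarely long. -/
lemma gaussianFamily_long_leaveOneOut_le (hn : 2 ≤ n) {k : ℕ} (hk : n + k ≤ d + 1) {η σ : ℝ}
    (h0 : 0 ≤ η) (h1 : η ≤ 1 / 2) (hσ : 0 ≤ σ) (hkσ : (n : ℝ) ≤ (1 - η) * k * σ ^ 2) (i : Fin n) :
    (gaussianFamily (Fin n) (EuclideanSpace ℝ (Fin d))).real {z | ∃ v,
      IsMinNormInterpolator (fun j : {j // ¬ j = i} => z j) v ∧ σ < ‖v‖} ≤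
      Real.exp (-(k * η ^ 2 / 8)) := by
  refine measureReal_le_of_le_ofReal (Real.exp_pos _).le ?_
  have hcard := card_subtype_ne i
  have : Nonempty {j // ¬ j = i} := Fintype.card_pos_iff.1 (by omega)
  refine le_trans (measure_mono ?_) ((gaussianFamily_preimage_restrict_le (· = i) _).trans
    (gaussianFamily_lt_norm_interpolator_le (d := d) h0 h1 (k := k) (by omega)))
  rintro z ⟨v, hv, hlt⟩
  refine ⟨v, hv, ?_⟩
  have hlt' : (Fintype.card {j // ¬ j = i} : ℝ) < n := by
    rw [hcard]; exact_mod_cast (by omega : n - 1 < n)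
  refine hlt'.trans_le (hkσ.trans ?_)
  have : 0 ≤ (1 - η) * k := mul_nonneg (by linarith) (by positivity)
  gcongr

lemma linearIndependent_restrict {κ E : Type*} [AddCommGroup E] [Module ℝ E] {z : κ → E}
    (hz : LinearIndependent ℝ z) (p : κ → Prop) :
    LinearIndependent ℝ fun j : {j // p j} => z j :=
  hz.comp _ Subtype.val_injective

lemma measureReal_not_linearIndependent_le {k : ℕ} (hk0 : 0 < k) (hk : n + k ≤ d + 1) :
    (gaussianFamily (Fin n) (EuclideanSpace ℝ (Fin d))).real {z | ¬ LinearIndependent ℝ z} ≤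
      n * Real.exp (-(k / 32 : ℝ)) := by
  refine measureReal_le_of_le_ofReal (by positivity) ?_
  refine (gaussianFamily_not_linearIndependent_le hk0 (by simpa using hk)).trans_eq ?_
  rw [ENNReal.ofReal_mul (by positivity), ENNReal.ofReal_natCast, Fintype.card_fin]

/-- Failure needs a degenerate sample, a leave-one-out interpolator longer than `σ`, or one of norm
at most `σ` whose product with the omitted vector reaches 1; each is bounded by a union bound. -/
theorem gaussianFamily_not_svp_le (hn : 2 ≤ n) {k : ℕ} (hk0 : 0 < k) (hk : n + k ≤ d + 1) {η σ : ℝ}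
    (h0 : 0 ≤ η) (h1 : η ≤ 1 / 2) (hσ : 0 ≤ σ) (hkσ : (n : ℝ) ≤ (1 - η) * k * σ ^ 2) :
    (gaussianFamily (Fin n) (EuclideanSpace ℝ (Fin d))).real {z | ¬ SVP z fun _ => 1} ≤
      n * Real.exp (-(k / 32 : ℝ)) +
        n * (Real.exp (-(k * η ^ 2 / 8)) + Real.exp (-(1 / (2 * σ ^ 2)))) := by
  set M := gaussianFamily (Fin n) (EuclideanSpace ℝ (Fin d))
  let A : Fin n → Set (Fin n → EuclideanSpace ℝ (Fin d)) := fun i => {z | ∃ v,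
    IsMinNormInterpolator (fun j : {j // ¬ j = i} => z j) v ∧ σ < ‖v‖}
  let B : Fin n → Set (Fin n → EuclideanSpace ℝ (Fin d)) := fun i =>
    {z | ‖minNormInterpolator fun j : {j // ¬ j = i} => z j‖ ≤ σ ∧
      1 ≤ inner ℝ (minNormInterpolator fun j : {j // ¬ j = i} => z j) (z i)}
  have hsub : {z : Fin n → EuclideanSpace ℝ (Fin d) | ¬ SVP z fun _ => 1} ⊆
      {z | ¬ LinearIndependent ℝ z} ∪ ⋃ i, (A i ∪ B i) := by
    intro z hz
    by_contra hcon
    simp only [Set.mem_union, Set.mem_iUnion, not_or, not_exists, Set.mem_ofPred_eq, not_not] at hcon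
    obtain ⟨hli, hAB⟩ := hcon
    refine hz (svp_of_inner_lt_one (isMinNormInterpolator_minNormInterpolator hli) fun i => ?_)
    have hv := isMinNormInterpolator_minNormInterpolator
      (linearIndependent_restrict hli fun j => ¬ j = i)
    refine ⟨_, hv, ?_⟩
    obtain ⟨hA, hB⟩ := hAB i
    by_contra! hge
    exact hB ⟨not_lt.1 fun hlt => hA ⟨_, hv, hlt⟩, hge⟩
  refine (measureReal_mono hsub).trans ((measureReal_union_le _ _).trans
    (add_le_add (measureReal_not_linearIndependent_le hk0 hk)
    ((measureReal_iUnion_fintype_le _).trans ((Finset.sum_le_card_nsmul _ _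
      (Real.exp (-(k * η ^ 2 / 8)) + Real.exp (-(1 / (2 * σ ^ 2)))) fun i _ => ?_).trans_eq ?_))))
  · refine (measureReal_union_le _ _).trans (add_le_add
      (gaussianFamily_long_leaveOneOut_le hn hk h0 h1 hσ hkσ i)
      (measureReal_le_of_le_ofReal (Real.exp_pos _).le ?_))
    refine (gaussianFamily_le_inner_le i measurable_minNormInterpolator one_pos).trans_eq ?_
    rw [one_pow]
  · rw [nsmul_eq_mul, Finset.card_univ, Fintype.card_fin]

/-- Outside the exceptional events, SVP forces `⟪w, z i⟫ ≤ 1 + t` for all `i ∈ S`, where `w` depends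
only on the vectors outside `S` and `‖w‖ ≥ τ`. Conditionally on `w` this is an intersection of
independent events, hence the power `S.card`. -/
theorem gaussianFamily_svp_le {S : Finset (Fin n)} (hS : S.card < n) (hS0 : S.Nonempty) {k : ℕ}
    (hk0 : 0 < k) (hk : n + k ≤ d + 1) {η σ τ ρ t : ℝ} (h0 : 0 ≤ η) (h1 : η ≤ 1 / 2) (ht : 0 < t)
    (hσ : 0 ≤ σ) (hkσ : (n : ℝ) ≤ (1 - η) * k * σ ^ 2) (hτ : 0 < τ)
    (hdτ : (1 + η) * d * τ ^ 2 ≤ (n : ℝ) - S.card) (hρ0 : 0 ≤ ρ) (hρ : σ ^ 2 - τ ^ 2 ≤ ρ ^ 2) :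
    (gaussianFamily (Fin n) (EuclideanSpace ℝ (Fin d))).real {z | SVP z fun _ => 1} ≤
      n * Real.exp (-(k / 32 : ℝ)) + Real.exp (-(d * η ^ 2 / 8)) +
        S.card * (Real.exp (-(k * η ^ 2 / 8)) + Real.exp (-(t ^ 2 / (2 * ρ ^ 2)))) +
        (1 - Real.exp (-(((1 + t) / τ + 1) ^ 2 / 2)) / 3) ^ S.card := by
  have hn : 2 ≤ n := by
    have := hS0.card_pos
    omega
  set M := gaussianFamily (Fin n) (EuclideanSpace ℝ (Fin d))
  let w : (Fin n → EuclideanSpace ℝ (Fin d)) → EuclideanSpace ℝ (Fin d) := fun z =>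
    minNormInterpolator fun j : {j // ¬ j ∈ S} => z j
  let v : Fin n → (Fin n → EuclideanSpace ℝ (Fin d)) → EuclideanSpace ℝ (Fin d) := fun i z =>
    minNormInterpolator fun j : {j // ¬ j = i} => z j
  let A : Fin n → Set (Fin n → EuclideanSpace ℝ (Fin d)) := fun i => {z | ∃ v,
    IsMinNormInterpolator (fun j : {j // ¬ j = i} => z j) v ∧ σ < ‖v‖}
  let B : Fin n → Set (Fin n → EuclideanSpace ℝ (Fin d)) := fun i =>
    {z | ‖w z - v i z‖ ≤ ρ ∧ t ≤ inner ℝ (w z - v i z) (z i)}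
  let C : Set (Fin n → EuclideanSpace ℝ (Fin d)) := {z | ∃ u,
    IsMinNormInterpolator (fun j : {j // ¬ j ∈ S} => z j) u ∧ ‖u‖ < τ}
  let D : Set (Fin n → EuclideanSpace ℝ (Fin d)) :=
    {z | τ ≤ ‖w z‖ ∧ ∀ i ∈ S, inner ℝ (w z) (z i) ≤ 1 + t}
  have hsub : {z : Fin n → EuclideanSpace ℝ (Fin d) | SVP z fun _ => 1} ⊆
      (({z | ¬ LinearIndependent ℝ z} ∪ C) ∪ ⋃ i ∈ S, (A i ∪ B i)) ∪ D := by
    intro z hz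
    by_contra hcon
    simp only [Set.mem_union, Set.mem_iUnion, not_or, not_exists, Set.mem_ofPred_eq, not_not] at hcon
    obtain ⟨⟨⟨hli, hC⟩, hAB⟩, hD⟩ := hcon
    have hw : IsMinNormInterpolator _ (w z) := isMinNormInterpolator_minNormInterpolator
      (linearIndependent_restrict hli fun j => ¬ j ∈ S)
    have hwτ : τ ≤ ‖w z‖ := not_lt.1 fun hlt => hC ⟨_, hw, hlt⟩
    refine hD ⟨hwτ, fun i hi => ?_⟩
    have hv : IsMinNormInterpolator _ (v i z) := isMinNormInterpolator_minNormInterpolator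
      (linearIndependent_restrict hli fun j => ¬ j = i)
    obtain ⟨hA, hB⟩ := hAB i hi
    have hvσ : ‖v i z‖ ≤ σ := not_lt.1 fun hlt => hA ⟨_, hv, hlt⟩
    -- As `i ∈ S`, `v i z` satisfies all the constraints that define `w z`, so Pythagoras applies.
    have h3 := hw.norm_sub_sq (v := v i z)
      fun j => hv.inner_eq ⟨j, fun h => j.2 (by rw [h]; exact hi)⟩
    have h4 : ‖w z - v i z‖ ≤ ρ := by
      rw [norm_sub_rev]
      refine le_of_sq_le_sq ?_ hρ0
      have h5 : ‖v i z‖ ^ 2 ≤ σ ^ 2 := by gcongr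
      have h6 : τ ^ 2 ≤ ‖w z‖ ^ 2 := by gcongr
      linarith
    have h5 : ¬ t ≤ inner ℝ (w z - v i z) (z i) := fun h => hB ⟨h4, h⟩
    rw [inner_sub_left] at h5
    have h6 := hz.inner_le_one hv
    linarith
  have hC : M.real C ≤ Real.exp (-(d * η ^ 2 / 8)) := by
    refine measureReal_le_of_le_ofReal (Real.exp_pos _).le ?_
    have hcard : Fintype.card {j // ¬ j ∈ S} = n - S.card := by
      rw [Fintype.card_subtype_compl, Fintype.card_coe, Fintype.card_fin]
    have : Nonempty {j // ¬ j ∈ S} := Fintype.card_pos_iff.1 (by omega)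
    refine le_trans (measure_mono ?_) ((gaussianFamily_preimage_restrict_le (· ∈ S) _).trans
      (gaussianFamily_norm_interpolator_le_le (d := d) h0 h1))
    rintro z ⟨u, hu, hlt⟩
    refine ⟨u, hu, ?_⟩
    rw [hcard, Nat.cast_sub hS.le]
    exact le_trans (by gcongr) hdτ
  have hB : ∀ i ∈ S, M.real (B i) ≤ Real.exp (-(t ^ 2 / (2 * ρ ^ 2))) := by
    intro i hi
    refine measureReal_le_of_le_ofReal (Real.exp_pos _).le ?_
    -- Both interpolators omit `z i`, so their difference is independent of it.
    let V : ({j // ¬ j = i} → EuclideanSpace ℝ (Fin d)) → EuclideanSpace ℝ (Fin d) := fun z =>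
      (minNormInterpolator fun j : {j // ¬ j ∈ S} => z ⟨j, fun h => j.2 (by rw [h]; exact hi)⟩) -
        minNormInterpolator z
    have hV : Measurable V := by
      refine Measurable.sub (measurable_minNormInterpolator.comp ?_) measurable_minNormInterpolator
      fun_prop
    exact gaussianFamily_le_inner_le i hV ht
  have hD : M.real D ≤ (1 - Real.exp (-(((1 + t) / τ + 1) ^ 2 / 2)) / 3) ^ S.card := by
    have hq : 0 ≤ 1 - Real.exp (-(((1 + t) / τ + 1) ^ 2 / 2)) / 3 := by
      have := Real.exp_le_one_iff.2 (neg_nonpos.2 (by positivity : 0 ≤ ((1 + t) / τ + 1) ^ 2 / 2))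
      linarith
    refine measureReal_le_of_le_ofReal (pow_nonneg hq _) ?_
    rw [ENNReal.ofReal_pow hq]
    exact gaussianFamily_forall_inner_le_le S measurable_minNormInterpolator (by linarith) hτ
  refine (measureReal_mono hsub).trans ((measureReal_union_le _ _).trans (add_le_add
    ((measureReal_union_le _ _).trans (add_le_add ((measureReal_union_le _ _).trans (add_le_add
      (measureReal_not_linearIndependent_le hk0 hk) hC)) ?_)) hD))
  refine (measureReal_biUnion_finset_le _ _).trans ((Finset.sum_le_card_nsmul _ _ _
    fun i hi => (measureReal_union_le _ _).trans (add_le_add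
      (gaussianFamily_long_leaveOneOut_le hn hk h0 h1 hσ hkσ i) (hB i hi))).trans_eq ?_)
  rw [nsmul_eq_mul]

end FiniteSampleBounds

/-! ### From an arbitrary sample to the canonical Gaussian family. -/

section Sample

variable {n d : ℕ} {Ω : Type*} [MeasurableSpace Ω] {P : Measure Ω}
  {x : Fin n → Ω → EuclideanSpace ℝ (Fin d)} {y : Fin n → ℝ}

lemma stdGaussian_pi_coord (s : Fin d → Set ℝ) (hs : ∀ a, MeasurableSet (s a)) :
    stdGaussian (EuclideanSpace ℝ (Fin d)) {v | ∀ a, v a ∈ s a} =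
      ∏ a, gaussianReal 0 1 (s a) := by
  have hset : {v : EuclideanSpace ℝ (Fin d) | ∀ a, v a ∈ s a} =
      ⋂ a, (fun v : EuclideanSpace ℝ (Fin d) => v a) ⁻¹' s a := by ext; simp
  rw [← map_pi_eq_stdGaussian, Measure.map_apply (by fun_prop)
    (hset ▸ MeasurableSet.iInter fun a => (by fun_prop : Measurable
      fun v : EuclideanSpace ℝ (Fin d) => v a) (hs a)), ← Measure.pi_pi]
  congr 1
  ext
  simp

lemma gaussianFamily_map_coord :
    (gaussianFamily (Fin n) (EuclideanSpace ℝ (Fin d))).map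
      (fun z (p : Fin n × Fin d) => z p.1 p.2) = Measure.pi fun _ => gaussianReal 0 1 := by
  symm
  refine Measure.pi_eq fun s hs => ?_
  rw [Measure.map_apply (by fun_prop) (MeasurableSet.univ_pi hs), Fintype.prod_prod_type]
  have hset : (fun (z : Fin n → EuclideanSpace ℝ (Fin d)) (p : Fin n × Fin d) => z p.1 p.2) ⁻¹'
      Set.univ.pi s = Set.univ.pi fun i => {v | ∀ a, v a ∈ s (i, a)} := by
    ext z; simp
  rw [hset, Measure.pi_pi]
  exact Finset.prod_congr rfl fun i _ => stdGaussian_pi_coord _ fun a => hs _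

lemma stdGaussian_map_coord (a : Fin d) :
    (stdGaussian (EuclideanSpace ℝ (Fin d))).map (fun v => v a) = gaussianReal 0 1 := by
  have h := stdGaussian_map_inner (EuclideanSpace.single a (1 : ℝ))
  simpa [EuclideanSpace.inner_single_left] using h

lemma IsIsotropicGaussianSample.map_eq (h : IsIsotropicGaussianSample P x y) :
    P.map (fun ω i => x i ω) = gaussianFamily (Fin n) (EuclideanSpace ℝ (Fin d)) := by
  have hx : AEMeasurable (fun ω i => x i ω) P := aemeasurable_pi_lambda _ fun i =>
    (h.law i).aemeasurable
  have h1 : (P.map (fun ω i => x i ω)).map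
      (fun (z : Fin n → EuclideanSpace ℝ (Fin d)) (p : Fin n × Fin d) => z p.1 p.2) =
      (gaussianFamily (Fin n) (EuclideanSpace ℝ (Fin d))).map fun z p => z p.1 p.2 := by
    rw [gaussianFamily_map_coord, AEMeasurable.map_map_of_aemeasurable (Measurable.aemeasurable (by fun_prop)) hx]
    refine (h.indep.hasLaw_pi (μ := fun _ => gaussianReal 0 1) fun p => ?_).map_eq
    refine ⟨(by fun_prop : Measurable fun v : EuclideanSpace ℝ (Fin d) => v p.2).comp_aemeasurable
      (h.law p.1).aemeasurable, ?_⟩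
    rw [← stdGaussian_map_coord p.2, ← (h.law p.1).map_eq,
      AEMeasurable.map_map_of_aemeasurable (by fun_prop) (h.law p.1).aemeasurable]
    rfl
  -- The passage to coordinates has a measurable left inverse, so equality of coordinate laws lifts
  -- back.
  have h2 (μ : Measure (Fin n → EuclideanSpace ℝ (Fin d))) :
      (μ.map fun z (p : Fin n × Fin d) => z p.1 p.2).map (fun g i =>
        (WithLp.toLp 2 fun a => g (i, a) : EuclideanSpace ℝ (Fin d))) = μ := by
    rw [Measure.map_map (by fun_prop) (by fun_prop)]
    exact Measure.map_id
  rw [← h2 (P.map _), h1, h2]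

lemma IsIsotropicGaussianSample.map_smul_eq (h : IsIsotropicGaussianSample P x y) :
    P.map (fun ω i => y i • x i ω) = gaussianFamily (Fin n) (EuclideanSpace ℝ (Fin d)) := by
  have hx : AEMeasurable (fun ω i => x i ω) P := aemeasurable_pi_lambda _ fun i =>
    (h.law i).aemeasurable
  have h1 : MeasurePreserving
      (fun (z : Fin n → EuclideanSpace ℝ (Fin d)) i => y i • z i)
      (gaussianFamily (Fin n) (EuclideanSpace ℝ (Fin d)))
      (gaussianFamily (Fin n) (EuclideanSpace ℝ (Fin d))) := by
    refine measurePreserving_pi _ _ fun i => ⟨by fun_prop, ?_⟩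
    rcases h.label i with hy | hy
    · rw [hy, show HSMul.hSMul (1 : ℝ) = (id : EuclideanSpace ℝ (Fin d) → _) from
        funext (one_smul ℝ), Measure.map_id]
    · rw [hy, show HSMul.hSMul (-1 : ℝ) = (LinearIsometryEquiv.neg ℝ :
        EuclideanSpace ℝ (Fin d) ≃ₗᵢ[ℝ] EuclideanSpace ℝ (Fin d)) from funext (neg_one_smul ℝ),
        stdGaussian_map]
  rw [← h1.map_eq, ← h.map_eq, AEMeasurable.map_map_of_aemeasurable (Measurable.aemeasurable (by fun_prop)) hx]
  rfl

/-- One inequality holds for arbitrary sets, so measurability of the SVP event is never needed;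
applied to the event and to its complement it gives both bounds. -/
lemma IsIsotropicGaussianSample.measureReal_le (h : IsIsotropicGaussianSample P x y)
    (s : Set (Fin n → EuclideanSpace ℝ (Fin d))) :
    P.real {ω | (fun i => y i • x i ω) ∈ s} ≤
      (gaussianFamily (Fin n) (EuclideanSpace ℝ (Fin d))).real s := by
  have hx : AEMeasurable (fun ω i => y i • x i ω) P := aemeasurable_pi_lambda _ fun i =>
    (h.law i).aemeasurable.const_smul (y i)
  refine ENNReal.toReal_mono (measure_ne_top _ _) ?_
  rw [← h.map_smul_eq]
  exact Measure.le_map_apply hx s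

lemma IsIsotropicGaussianSample.svp_le (h : IsIsotropicGaussianSample P x y) :
    P.real {ω | SVP (fun i => x i ω) y} ≤
      (gaussianFamily (Fin n) (EuclideanSpace ℝ (Fin d))).real {z | SVP z fun _ => 1} := by
  simp_rw [svp_iff_svp_smul _ y]
  exact h.measureReal_le {z | SVP z fun _ => 1}

lemma IsIsotropicGaussianSample.le_svp [IsProbabilityMeasure P]
    (h : IsIsotropicGaussianSample P x y) :
    1 - (gaussianFamily (Fin n) (EuclideanSpace ℝ (Fin d))).real {z | ¬ SVP z fun _ => 1} ≤
      P.real {ω | SVP (fun i => x i ω) y} := by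
  have h1 := h.measureReal_le {z | ¬ SVP z fun _ => 1}
  have h2 : P.real Set.univ ≤ P.real {ω | SVP (fun i => x i ω) y} +
      P.real {ω | (fun i => y i • x i ω) ∈ {z | ¬ SVP z fun _ => 1}} := by
    refine (measureReal_mono fun ω _ => ?_).trans (measureReal_union_le _ _)
    simp only [Set.mem_union, Set.mem_ofPred_eq, ← svp_iff_svp_smul]
    exact em _
  rw [probReal_univ] at h2
  linarith

end Sample

/-! ### Choice of parameters and the limit. -/

section Asymptotics

lemma mul_exp_neg_le_exp_neg_log {n : ℕ} (hn : 0 < n) {a : ℝ} (ha : 2 * Real.log n ≤ a) :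
    n * Real.exp (-a) ≤ Real.exp (-Real.log n) := by
  have h0 : (0 : ℝ) < n := by exact_mod_cast hn
  nth_rw 1 [← Real.exp_log h0]
  rw [← Real.exp_add, Real.exp_le_exp]
  linarith

/-- The relative error is `η = 1 / log n`: large enough for chi-square tails to beat the factor `n`,
and small enough to change an exponent of order `log n` only by `O(1)`. -/
lemma mul_exp_neg_dimension_le {n : ℕ} {c k : ℝ} (hL : 2 ≤ Real.log n)
    (hn : 16 * Real.log n ^ 2 ≤ c * n) (hk : c * n * Real.log n ≤ k) :
    n * Real.exp (-(k / 32)) ≤ Real.exp (-Real.log n) ∧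
      n * Real.exp (-(k * (1 / Real.log n) ^ 2 / 8)) ≤ Real.exp (-Real.log n) := by
  have h0 : 0 < n := Nat.pos_of_ne_zero fun h => by simp [h] at hL; linarith
  set L := Real.log n
  have hL0 : 0 < L := by linarith
  have hk' : 16 * L ^ 2 * L ≤ k := le_trans (by gcongr) hk
  constructor
  · refine mul_exp_neg_le_exp_neg_log h0 ?_
    change 2 * L ≤ k / 32
    rw [le_div_iff₀ (by norm_num)]
    nlinarith [mul_le_mul hL hL (by norm_num) hL0.le]
  · refine mul_exp_neg_le_exp_neg_log h0 ?_
    change 2 * L ≤ _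
    calc 2 * L = 16 * L ^ 2 * L * (1 / L) ^ 2 / 8 := by field_simp; ring
      _ ≤ _ := by gcongr

lemma svp_dimension_above {n d : ℕ} (hL : 25 ≤ Real.log n) (hn : 16 * Real.log n ^ 2 ≤ n)
    (hd : 2 * n * Real.log n + 4 * n * √(Real.log n) ≤ d) :
    (gaussianFamily (Fin n) (EuclideanSpace ℝ (Fin d))).real {z | ¬ SVP z fun _ => 1} ≤
      4 * Real.exp (-Real.log n) + Real.exp (-√(Real.log n)) := by
  have h0 : 0 < n := Nat.pos_of_ne_zero fun h => by simp [h] at hL; linarith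
  have hn0 : (0 : ℝ) < n := by exact_mod_cast h0
  have hnexp := Real.exp_log hn0
  set L := Real.log n
  set s := √L
  have hs : s ^ 2 = L := Real.sq_sqrt (by linarith)
  have hs5 : 5 ≤ s := Real.le_sqrt_of_sq_le (by linarith)
  have hnL : (n : ℝ) ≤ d := by
    nlinarith [mul_pos hn0 (by linarith : 0 < s), mul_le_mul_of_nonneg_left hL hn0.le]
  have hnd : n ≤ d := by exact_mod_cast hnL
  have hkeq : ((d + 1 - n : ℕ) : ℝ) = d + 1 - n := by
    rw [Nat.cast_sub (by omega)]; push_cast; ring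
  set k := d + 1 - n
  have hk : n * (2 * L + 4 * s - 1) ≤ k := by rw [hkeq]; nlinarith
  have hk1 : 1 * n * L ≤ (k : ℝ) := le_trans (by nlinarith) hk
  have hk0 : (0 : ℝ) < k := lt_of_lt_of_le (by positivity) hk1
  obtain ⟨he1, he2⟩ := mul_exp_neg_dimension_le (by linarith) (by simpa using hn) hk1
  have hη : 1 / L ≤ 1 / 25 := one_div_le_one_div_of_le (by norm_num) hL
  have hη0 : 0 < 1 / L := by positivity
  have hq : 0 < (1 - 1 / L) * k := mul_pos (by linarith) hk0
  have hσ : √(n / ((1 - 1 / L) * k)) ^ 2 = n / ((1 - 1 / L) * k) := Real.sq_sqrt (by positivity)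
  have h2n : 2 ≤ n := by
    by_contra! h
    have : (n : ℝ) ≤ 1 := by exact_mod_cast (by omega : n ≤ 1)
    nlinarith
  have key := gaussianFamily_not_svp_le (n := n) (d := d) h2n (k := k) (by exact_mod_cast hk0)
    (by omega) (η := 1 / L) (σ := √(n / ((1 - 1 / L) * k))) hη0.le (by linarith)
    (Real.sqrt_nonneg _) (by rw [hσ, mul_div_cancel₀ _ hq.ne'])
  -- The exponent is `(1 - 1 / L) * k / (2n) ≥ L + 2s - 2`; `L` cancels the factor `n`, and at least
  -- `s` remains.
  have he3 : n * Real.exp (-(1 / (2 * √(n / ((1 - 1 / L) * k)) ^ 2))) ≤ Real.exp (-s) := by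
    nth_rw 1 [← hnexp]
    rw [← Real.exp_add, Real.exp_le_exp, hσ]
    have h1 : 1 / (2 * (n / ((1 - 1 / L) * k))) = (1 - 1 / L) * (k / n) / 2 := by
      have : (1 - 1 / L) ≠ 0 := by linarith
      field_simp
    rw [h1]
    have h2 : 2 * L + 4 * s - 1 ≤ k / n := by rw [le_div_iff₀ hn0]; linarith
    have h3 : (1 - 1 / L) * (2 * L + 4 * s - 1) ≤ (1 - 1 / L) * (k / n) :=
      mul_le_mul_of_nonneg_left h2 (by linarith)
    have h4 : 1 / L * (2 * L + 4 * s) ≤ 3 := by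
      rw [one_div_mul_eq_div, div_le_iff₀ (by linarith)]
      nlinarith
    nlinarith
  rw [mul_add] at key
  have := Real.exp_pos (-L)
  linarith

/-- Both terms are `n / d = O(1 / L)` up to relative errors `O(1 / L)`, coming from `η`, from `k`
against `d`, and from the removed `m` points. The bound `d ≥ c n L` enters here and makes the width
constant depend on `c`. -/
lemma interpolator_norm_gap {c L n d m k : ℝ} (hc : 0 < c) (hL : 8 ≤ L) (hcL : 4 ≤ c * L)
    (hn : 0 < n) (hd : c * n * L ≤ d) (hm : m ≤ 2 * n / L) (hk : d - n ≤ k) :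
    n / ((1 - 1 / L) * k) - (n - m) / ((1 + 1 / L) * d) ≤ (5 + 2 / c) / c / L ^ 2 := by
  have hL0 : 0 < L := by linarith
  have hd4 : 4 * n ≤ d := le_trans (by nlinarith) hd
  have hd0 : 0 < d := by linarith
  obtain ⟨e, he⟩ : ∃ e, e = 1 / L := ⟨_, rfl⟩
  have he0 : 0 < e := by rw [he]; positivity
  have he8 : e ≤ 1 / 8 := by rw [he]; exact one_div_le_one_div_of_le (by norm_num) hL
  obtain ⟨a, ha⟩ : ∃ a, a = n / d := ⟨_, rfl⟩
  have ha0 : 0 < a := by rw [ha]; positivity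
  have ha4 : a ≤ 1 / 4 := by rw [ha, div_le_iff₀ hd0]; linarith
  have hac : a ≤ e / c := by
    rw [ha, he, div_div, div_le_div_iff₀ hd0 (by positivity)]
    nlinarith
  have h1 : n / ((1 - e) * k) ≤ a * (1 + 2 * (e + a)) := by
    have h2 : (1 - e) * (d - n) ≤ (1 - e) * k := mul_le_mul_of_nonneg_left hk (by linarith)
    have h3 : 0 < (1 - e) * (d - n) := mul_pos (by linarith) (by linarith)
    have h4 : n = a * d := by rw [ha]; field_simp
    calc n / ((1 - e) * k) ≤ n / ((1 - e) * (d - n)) := by gcongr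
      _ ≤ a * (1 + 2 * (e + a)) := by
        rw [div_le_iff₀ h3, h4]
        have h5 : 1 ≤ (1 + 2 * (e + a)) * ((1 - e) * (1 - a)) := by nlinarith [mul_pos he0 ha0]
        calc a * d = a * d * 1 := by ring
          _ ≤ a * d * ((1 + 2 * (e + a)) * ((1 - e) * (1 - a))) := by gcongr
          _ = _ := by ring
  have h6 : a * (1 - 3 * e) ≤ (n - m) / ((1 + e) * d) := by
    rw [le_div_iff₀ (by positivity)]
    have h7 : n * (1 - 2 * e) ≤ n - m := by
      rw [mul_sub, he]
      have : n * (2 * (1 / L)) = 2 * n / L := by ring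
      linarith
    have h4 : n = a * d := by rw [ha]; field_simp
    calc a * (1 - 3 * e) * ((1 + e) * d) = a * d * ((1 - 3 * e) * (1 + e)) := by ring
      _ = n * ((1 - 3 * e) * (1 + e)) := by rw [← h4]
      _ ≤ n * (1 - 2 * e) := by
        refine mul_le_mul_of_nonneg_left ?_ hn.le
        nlinarith
      _ ≤ n - m := h7
  rw [← he]
  have h8 : (5 + 2 / c) / c / L ^ 2 = e / c * (5 * e + 2 * (e / c)) := by
    rw [he]; field_simp
  rw [h8]
  calc n / ((1 - e) * k) - (n - m) / ((1 + e) * d)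
      ≤ a * (1 + 2 * (e + a)) - a * (1 - 3 * e) := by linarith
    _ = a * (5 * e + 2 * a) := by ring
    _ ≤ _ := by gcongr

/-- The factor `1 + t` costs at most `3 t u² ≤ 24 B s` and the shift by 1 at most `4u + 1 ≤ 8s + 1`;
the gain `C s` covers both with room to spare. -/
lemma gaussian_exponent_le {L s C B u t : ℝ} (hs : s ^ 2 = L) (hs5 : 5 ≤ s) (hB : 0 ≤ B)
    (hC : 24 * B + 16 ≤ C) (hu0 : 0 ≤ u) (hu : u ^ 2 ≤ 2 * L - C * s + 8) (ht0 : 0 ≤ t) (ht1 : t ≤ 1)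
    (ht : t * s = 2 * B) : ((1 + t) * u + 1) ^ 2 / 2 ≤ L - 2 * s := by
  have hCs : (24 * B + 16) * s ≤ C * s := by gcongr
  have hBs : 0 ≤ B * s := by positivity
  have hu2 : u ≤ 2 * s := by
    refine le_of_sq_le_sq ?_ (by linarith)
    nlinarith
  have h1 : t * u ^ 2 ≤ 8 * (B * s) := by
    calc t * u ^ 2 ≤ t * (2 * s) ^ 2 := by gcongr
      _ = 4 * (t * s) * s := by ring
      _ = 8 * (B * s) := by rw [ht]; ring
  have h2 : t ^ 2 * u ^ 2 ≤ t * u ^ 2 := by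
    have : t ^ 2 ≤ t := by nlinarith
    gcongr
  have h3 : t * u ≤ u := mul_le_of_le_one_left hu0 ht1
  nlinarith

lemma one_add_inv_mul_le {L n m d D : ℝ} (hL : 8 ≤ L) (hn : 0 ≤ n) (hd : d ≤ n * D) (hD0 : 0 ≤ D)
    (hD : D ≤ 2 * L) (hm : n * (1 - 2 / L) ≤ n - m) :
    (1 + 1 / L) * d ≤ (D + 8) * (n - m) := by
  have hL0 : 0 < L := by linarith
  have h1 : 1 / L * D ≤ 2 := by rw [one_div_mul_eq_div, div_le_iff₀ hL0]; exact hD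
  have h2 : 1 / L ≤ 1 / 8 := one_div_le_one_div_of_le (by norm_num) hL
  calc (1 + 1 / L) * d ≤ (1 + 1 / L) * (n * D) := by gcongr
    _ = n * (D + 1 / L * D) := by ring
    _ ≤ n * (D + 8 - 2 * (1 / L * D) - 16 * (1 / L)) :=
      mul_le_mul_of_nonneg_left (by linarith) hn
    _ = (D + 8) * (n * (1 - 2 / L)) := by ring
    _ ≤ _ := mul_le_mul_of_nonneg_left hm (by linarith)

/-- The expected number of exceedances is at least `(n / L) * exp (-(L - 2s)) / 3 = exp (2s) / (3
s²) ≥ s`, and `(1 - p)^m ≤ exp (-m p)`. -/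
lemma one_sub_exp_neg_div_pow_le {L s n a : ℝ} {m : ℕ} (hs : s ^ 2 = L) (hs5 : 5 ≤ s)
    (hn : Real.exp L = n) (hm : n / L ≤ m) (ha0 : 0 ≤ a) (ha : a ≤ L - 2 * s) :
    (1 - Real.exp (-a) / 3) ^ m ≤ Real.exp (-s) := by
  have hs0 : 0 < s := by linarith
  have hL0 : 0 < L := by rw [← hs]; positivity
  have hn0 : 0 < n := by rw [← hn]; exact Real.exp_pos _
  have ha1 : Real.exp (-a) ≤ 1 := Real.exp_le_one_iff.2 (neg_nonpos.2 ha0)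
  have hms : s ≤ m * (Real.exp (-a) / 3) := by
    have h1 : (2 * s) ^ 4 / (Nat.factorial 4) ≤ Real.exp (2 * s) :=
      Real.pow_div_factorial_le_exp _ (by linarith) 4
    have h2 : 3 * s ^ 3 ≤ Real.exp (2 * s) := by
      refine le_trans ?_ h1
      rw [le_div_iff₀ (by positivity)]
      norm_num [Nat.factorial]
      nlinarith [pow_pos hs0 3]
    calc s = 3 * s ^ 3 / (3 * s ^ 2) := by field_simp
      _ ≤ Real.exp (2 * s) / (3 * s ^ 2) := by gcongr
      _ = n / L * (Real.exp (-(L - 2 * s)) / 3) := by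
        rw [neg_sub, Real.exp_sub, hn, hs]
        field_simp
      _ ≤ m * (Real.exp (-a) / 3) := by gcongr
  calc (1 - Real.exp (-a) / 3) ^ m ≤ Real.exp (-(Real.exp (-a) / 3)) ^ m := by
        refine pow_le_pow_left₀ (by linarith) ?_ _
        linarith [Real.add_one_le_exp (-(Real.exp (-a) / 3))]
    _ = Real.exp (-(m * (Real.exp (-a) / 3))) := by rw [← Real.exp_nat_mul]; ring_nf
    _ ≤ Real.exp (-s) := by gcongr

lemma svp_dimension_below {c C : ℝ} (hc : 0 < c) (hC : 24 * √((5 + 2 / c) / c) + 16 ≤ C) {n d : ℕ}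
    (hL : 25 ≤ Real.log n) (hcL : 4 ≤ c * Real.log n)
    (hKL : 4 * ((5 + 2 / c) / c) ≤ Real.log n) (hn : 16 * Real.log n ^ 2 ≤ c / 2 * n)
    (hd1 : c * n * Real.log n ≤ d) (hd2 : (d : ℝ) ≤ 2 * n * Real.log n - C * n * √(Real.log n)) :
    (gaussianFamily (Fin n) (EuclideanSpace ℝ (Fin d))).real {z | SVP z fun _ => 1} ≤
      4 * Real.exp (-Real.log n) + Real.exp (-√(Real.log n)) := by
  have h0 : 0 < n := Nat.pos_of_ne_zero fun h => by simp [h] at hL; linarith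
  have hn0 : (0 : ℝ) < n := by exact_mod_cast h0
  have hnexp := Real.exp_log hn0
  have hLn : Real.log n ≤ n := (Real.log_le_sub_one_of_pos hn0).trans (by linarith)
  set L := Real.log n
  set s := √L
  have hL0 : 0 < L := by linarith
  have hs : s ^ 2 = L := Real.sq_sqrt (by linarith)
  have hs5 : 5 ≤ s := Real.le_sqrt_of_sq_le (by linarith)
  obtain ⟨K, hK⟩ : ∃ K, K = (5 + 2 / c) / c := ⟨_, rfl⟩
  have hK0 : 0 < K := by rw [hK]; positivity
  rw [← hK] at hC hKL
  obtain ⟨B, hB⟩ : ∃ B, B = √K := ⟨_, rfl⟩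
  have hB0 : 0 < B := by rw [hB]; positivity
  have hB2 : B ^ 2 = K := by rw [hB]; exact Real.sq_sqrt hK0.le
  rw [← hB] at hC
  have hBs : 2 * B ≤ s := Real.le_sqrt_of_sq_le (by rw [mul_pow, hB2]; linarith)
  have hd4 : 4 * (n : ℝ) ≤ d := le_trans (by nlinarith) hd1
  have hd0 : (0 : ℝ) < d := by linarith
  have hnd : n ≤ d := by exact_mod_cast (by linarith : (n : ℝ) ≤ d)
  have hkeq : ((d + 1 - n : ℕ) : ℝ) = d + 1 - n := by
    rw [Nat.cast_sub (by omega)]; push_cast; ring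
  set k := d + 1 - n
  have hk : (d : ℝ) - n ≤ k := by rw [hkeq]; linarith
  have hk1 : c / 2 * n * L ≤ (k : ℝ) := by nlinarith
  have hk0 : (0 : ℝ) < k := lt_of_lt_of_le (by positivity) hk1
  have hkd : (k : ℝ) ≤ d := by
    have : (1 : ℝ) ≤ n := by exact_mod_cast h0
    rw [hkeq]; linarith
  obtain ⟨he1, he2⟩ := mul_exp_neg_dimension_le (by linarith) hn hk1
  have hη : 1 / L ≤ 1 / 25 := one_div_le_one_div_of_le (by norm_num) hL
  have hη0 : 0 < 1 / L := by positivity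
  -- Removing `n / L` points changes `‖w‖²` only by a relative `O(1 / L)`, while using `n / L`
  -- trials instead of `n` costs only `log L` in the exponent.
  obtain ⟨m, hm⟩ : ∃ m, m = ⌈(n : ℝ) / L⌉₊ := ⟨_, rfl⟩
  have hm1 : (n : ℝ) / L ≤ m := by rw [hm]; exact Nat.le_ceil _
  have hm2 : (m : ℝ) ≤ 2 * n / L := by
    have h1 := Nat.ceil_lt_add_one (by positivity : 0 ≤ (n : ℝ) / L)
    rw [← hm] at h1
    have h2 : 1 ≤ (n : ℝ) / L := by rwa [one_le_div hL0]
    have h3 : 2 * (n : ℝ) / L = n / L + n / L := by ring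
    linarith
  have hm0 : 0 < m := by
    have : (0 : ℝ) < m := lt_of_lt_of_le (by positivity) hm1
    exact_mod_cast this
  have hmL : (n : ℝ) * (1 - 2 / L) ≤ n - m := by
    have : (n : ℝ) * (1 - 2 / L) = n - 2 * n / L := by ring
    linarith
  have h2L : 2 / L = 2 * (1 / L) := by ring
  have hmpos : (0 : ℝ) < n - m := lt_of_lt_of_le (mul_pos hn0 (by rw [h2L]; linarith)) hmL
  have hmn : m < n := by exact_mod_cast (by linarith : (m : ℝ) < n)
  obtain ⟨S, -, hS⟩ := Finset.exists_subset_card_eq (s := (Finset.univ : Finset (Fin n))) (n := m)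
    (by simpa using hmn.le)
  have hq : 0 < (1 - 1 / L) * k := mul_pos (by linarith) hk0
  have hσ : √(n / ((1 - 1 / L) * k)) ^ 2 = n / ((1 - 1 / L) * k) := Real.sq_sqrt (by positivity)
  obtain ⟨τ, hτ⟩ : ∃ τ, τ = √((n - m) / ((1 + 1 / L) * d)) := ⟨_, rfl⟩
  have hτ2 : τ ^ 2 = (n - m) / ((1 + 1 / L) * d) := by
    rw [hτ]; exact Real.sq_sqrt (by positivity)
  have hτ0 : 0 < τ := by rw [hτ]; positivity
  -- `ρ = B / L` is the norm gap, and `t = 2B / s` makes `t² / (2ρ²) = 2L`, which beats the union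
  -- bound over `S`.
  have key := gaussianFamily_svp_le (n := n) (d := d) (S := S) (by rw [hS]; exact hmn)
    (Finset.card_pos.1 (by rw [hS]; exact hm0)) (k := k) (by exact_mod_cast hk0)
    (by omega) (η := 1 / L) (σ := √(n / ((1 - 1 / L) * k))) (τ := τ) (ρ := B / L) (t := 2 * B / s)
    hη0.le (by linarith) (by positivity) (Real.sqrt_nonneg _) (by rw [hσ, mul_div_cancel₀ _ hq.ne'])
    hτ0 (by rw [hτ2, hS]; field_simp; rfl) (by positivity)
    (by rw [hσ, hτ2, div_pow, hB2, hK]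
        exact interpolator_norm_gap hc (by linarith) hcL hn0 hd1 hm2 hk)
  rw [hS] at key
  have he3 : Real.exp (-(d * (1 / L) ^ 2 / 8)) ≤ Real.exp (-L) := by
    refine le_trans ?_ he2
    have h1 : Real.exp (-(d * (1 / L) ^ 2 / 8)) ≤ Real.exp (-(k * (1 / L) ^ 2 / 8)) := by gcongr
    have h2 : (1 : ℝ) ≤ n := by exact_mod_cast h0
    exact h1.trans (le_mul_of_one_le_left (Real.exp_pos _).le h2)
  have hmn' : (m : ℝ) ≤ n := by linarith
  have he4 : m * Real.exp (-(k * (1 / L) ^ 2 / 8)) ≤ Real.exp (-L) :=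
    le_trans (by gcongr) he2
  have he5 : m * Real.exp (-((2 * B / s) ^ 2 / (2 * (B / L) ^ 2))) ≤ Real.exp (-L) := by
    refine le_trans (mul_le_mul_of_nonneg_right hmn' (Real.exp_pos _).le)
      (mul_exp_neg_le_exp_neg_log h0 (le_of_eq ?_))
    change 2 * L = _
    rw [div_pow, hs]
    field_simp
  have hu : τ⁻¹ ^ 2 ≤ 2 * L - C * s + 8 := by
    rw [inv_pow, hτ2, inv_div, div_le_iff₀ hmpos]
    have hD : (d : ℝ) ≤ n * (2 * L - C * s) := by linarith
    have hD0 : 0 ≤ 2 * L - C * s := by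
      by_contra! h
      linarith [mul_neg_of_pos_of_neg hn0 h]
    have hCs : 0 ≤ C * s := mul_nonneg (by linarith) (by linarith)
    exact one_add_inv_mul_le (by linarith) hn0.le hD hD0 (by linarith) hmL
  have hexp := gaussian_exponent_le hs hs5 hB0.le hC (inv_nonneg.2 hτ0.le) hu
    (t := 2 * B / s) (by positivity) (by rw [div_le_one (by linarith)]; exact hBs)
    (by field_simp)
  rw [← div_eq_mul_inv] at hexp
  have he6 : (1 - Real.exp (-(((1 + 2 * B / s) / τ + 1) ^ 2 / 2)) / 3) ^ m ≤ Real.exp (-s) :=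
    one_sub_exp_neg_div_pow_le hs hs5 hnexp hm1 (by positivity) hexp
  rw [mul_add] at key
  linarith

lemma tendsto_log_natCast : Tendsto (fun n : ℕ => Real.log n) atTop atTop :=
  Real.tendsto_log_atTop.comp tendsto_natCast_atTop_atTop

lemma eventually_log_sq_le {c : ℝ} (hc : 0 < c) :
    ∀ᶠ n : ℕ in atTop, 16 * Real.log n ^ 2 ≤ c * n := by
  have h := (Real.isLittleO_pow_log_id_atTop (n := 2)).comp_tendsto
    (tendsto_natCast_atTop_atTop (R := ℝ))
  filter_upwards [h.def (by positivity : 0 < c / 16)] with n hn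
  simp only [Function.comp_apply, id, norm_pow, Real.norm_eq_abs, sq_abs, Nat.abs_cast] at hn
  linarith

lemma tendsto_failure_bound :
    Tendsto (fun n : ℕ => 4 * Real.exp (-Real.log n) + Real.exp (-√(Real.log n))) atTop (𝓝 0) := by
  have h1 := Real.tendsto_exp_neg_atTop_nhds_zero.comp tendsto_log_natCast
  have h2 := Real.tendsto_exp_neg_atTop_nhds_zero.comp
    (Real.tendsto_sqrt_atTop.comp tendsto_log_natCast)
  simpa using (h1.const_mul 4).add h2

/-- The constant in the width of the phase transition. -/
noncomputable def widthConstant (c : ℝ) : ℝ := 24 * √((5 + 2 / c) / c) + 16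

lemma svp_transition_window {c : ℝ} (hc : 0 < c) {δ : ℝ} (hδ : 0 < δ) : ∀ᶠ n : ℕ in atTop,
    ∀ (d : ℕ) (Ω : Type u) [MeasurableSpace Ω] (P : Measure Ω) [IsProbabilityMeasure P]
      (x : Fin n → Ω → EuclideanSpace ℝ (Fin d)) (y : Fin n → ℝ),
      IsIsotropicGaussianSample P x y →
      (c * n * Real.log n ≤ d → (d : ℝ) ≤ 2 * n * Real.log n - widthConstant c * n * √(Real.log n) →
        P.real {ω | SVP (fun i => x i ω) y} ≤ δ) ∧
      (2 * n * Real.log n + widthConstant c * n * √(Real.log n) ≤ d →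
        1 - δ ≤ P.real {ω | SVP (fun i => x i ω) y}) := by
  filter_upwards [tendsto_failure_bound.eventually_le_const hδ,
    tendsto_log_natCast.eventually_ge_atTop 25, tendsto_log_natCast.eventually_ge_atTop (4 / c),
    tendsto_log_natCast.eventually_ge_atTop (4 * ((5 + 2 / c) / c)),
    eventually_log_sq_le (half_pos hc), eventually_log_sq_le one_pos] with n h1 h2 h3 h4 h5 h6
  intro d Ω _ P _ x y h
  refine ⟨fun hd1 hd2 => ?_, fun hd => ?_⟩
  · refine h.svp_le.trans (le_trans (svp_dimension_below hc le_rfl h2 ?_ h4 h5 hd1 hd2) h1)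
    rwa [div_le_iff₀' hc] at h3
  · have hd' : 2 * n * Real.log n + 4 * n * √(Real.log n) ≤ d := by
      refine le_trans ?_ hd
      have : 4 ≤ widthConstant c := by
        rw [widthConstant]
        linarith [Real.sqrt_nonneg ((5 + 2 / c) / c)]
      gcongr
    have h7 := svp_dimension_above h2 (by simpa using h6) hd'
    have h8 := h.le_svp
    linarith

theorem theorem4p1 (c₁ : ℝ) (hc₁ : 0 < c₁) :
    ∃ C₂ : ℝ, 0 < C₂ ∧
      -- limits along every admissible sequence
      (∀ ε : ℕ → ℝ, (∀ n, 1 ≤ n → 0 < ε n) →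
        limsup (fun n => (ε n : EReal)) atTop < ((2 - c₁ : ℝ) : EReal) →
        (C₂ : EReal) < liminf (fun n : ℕ => ((ε n * √(Real.log n) : ℝ) : EReal)) atTop →
        ∀ (d : ℕ → ℕ) (Ω : ℕ → Type u) [∀ n, MeasurableSpace (Ω n)]
          (P : ∀ n, Measure (Ω n)) [∀ n, IsProbabilityMeasure (P n)]
          (x : ∀ n, Fin n → Ω n → EuclideanSpace ℝ (Fin (d n))) (y : ∀ n, Fin n → ℝ),
          (∀ n, IsIsotropicGaussianSample (P n) (x n) (y n)) →
          ((∀ᶠ n : ℕ in atTop, |(d n : ℝ) - (2 - ε n) * n * Real.log n| < 1) →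
            Tendsto (fun n => P n {ω | SVP (fun i => x n i ω) (y n)}) atTop (𝓝 0)) ∧
          ((∀ᶠ n : ℕ in atTop, |(d n : ℝ) - (2 + ε n) * n * Real.log n| < 1) →
            Tendsto (fun n => P n {ω | SVP (fun i => x n i ω) (y n)}) atTop (𝓝 1))) ∧
      -- the transition takes place within `C₂ * n * √(log n)` of `2 * n * log n`
      (∀ δ : ℝ, 0 < δ → ∀ᶠ n : ℕ in atTop,
        ∀ (d : ℕ) (Ω : Type u) [MeasurableSpace Ω] (P : Measure Ω) [IsProbabilityMeasure P]
          (x : Fin n → Ω → EuclideanSpace ℝ (Fin d)) (y : Fin n → ℝ),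
          IsIsotropicGaussianSample P x y →
          (c₁ * n * Real.log n ≤ d → (d : ℝ) ≤ 2 * n * Real.log n - C₂ * n * √(Real.log n) →
            P.real {ω | SVP (fun i => x i ω) y} ≤ δ) ∧
          (2 * n * Real.log n + C₂ * n * √(Real.log n) ≤ d →
            (d : ℝ) ≤ (4 - c₁) * n * Real.log n →
            1 - δ ≤ P.real {ω | SVP (fun i => x i ω) y})) := by
  refine ⟨widthConstant c₁, by unfold widthConstant; positivity, ?_, fun δ hδ => ?_⟩
  · intro ε _ hsup hinf d Ω _ P _ x y hxy
    obtain ⟨b, hb1, hb2⟩ := EReal.lt_iff_exists_real_btwn.1 hsup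
    obtain ⟨a, ha1, ha2⟩ := EReal.lt_iff_exists_real_btwn.1 hinf
    have hb : ∀ᶠ n in atTop, ε n < b :=
      (eventually_lt_of_limsup_lt hb1).mono fun n h => EReal.coe_lt_coe_iff.1 h
    have ha : ∀ᶠ n : ℕ in atTop, a < ε n * √(Real.log n) :=
      (eventually_lt_of_lt_liminf ha2).mono fun n h => EReal.coe_lt_coe_iff.1 h
    have hb2' : b < 2 - c₁ := EReal.coe_lt_coe_iff.1 hb2
    have ha1' : widthConstant c₁ < a := EReal.coe_lt_coe_iff.1 ha1
    have hprod {e : ℝ} (he : 0 < e) : ∀ᶠ n : ℕ in atTop, 1 ≤ e * (n * √(Real.log n)) := by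
      have h := (tendsto_natCast_atTop_atTop (R := ℝ)).atTop_mul_atTop₀
        (Real.tendsto_sqrt_atTop.comp tendsto_log_natCast)
      filter_upwards [h.eventually_ge_atTop (1 / e)] with n hn
      rw [div_le_iff₀' he] at hn
      exact hn
    -- The slack `a - widthConstant c₁ > 0`, multiplied by `n √(log n)`, absorbs the rounding error
    -- of `d n`.
    have hwidth : ∀ᶠ n : ℕ in atTop,
        widthConstant c₁ * n * √(Real.log n) + 1 ≤ ε n * n * Real.log n := by
      filter_upwards [ha, hprod (sub_pos.2 ha1'), tendsto_log_natCast.eventually_ge_atTop 0]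
        with n h1 h2 h3
      have h4 : 0 ≤ n * √(Real.log n) := by positivity
      have h5 : ε n * n * Real.log n = ε n * √(Real.log n) * (n * √(Real.log n)) := by
        nth_rw 1 [← Real.mul_self_sqrt h3]; ring
      rw [h5]
      nlinarith [mul_le_mul_of_nonneg_right h1.le h4]
    constructor
    · intro hd
      rw [← ENNReal.tendsto_toReal_zero_iff (fun n => measure_ne_top _ _)]
      refine tendsto_order.2 ⟨fun r hr => .of_forall fun n => hr.trans_le ENNReal.toReal_nonneg,
        fun r hr => ?_⟩
      filter_upwards [svp_transition_window hc₁ (half_pos hr), hd, hwidth, hb,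
        hprod (sub_pos.2 hb2'), tendsto_log_natCast.eventually_ge_atTop 1] with n h1 h2 h3 h4 h5 h6
      rw [abs_lt] at h2
      have h7 : √(Real.log n) ≤ Real.log n := Real.sqrt_le_iff.2 ⟨by linarith, by nlinarith⟩
      have h8 : n * √(Real.log n) ≤ n * Real.log n := by gcongr
      have h9 : 0 ≤ n * Real.log n := by positivity
      -- Since `ε n < b < 2 - c₁`, the slack `2 - c₁ - b` gives `c₁ n log n ≤ d n` after rounding.
      have := (h1 (d n) (Ω n) (P n) (x n) (y n) (hxy n)).1
        (by nlinarith [mul_le_mul_of_nonneg_right h4.le h9,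
          mul_le_mul_of_nonneg_left h8 (sub_pos.2 hb2').le]) (by linarith)
      exact this.trans_lt (by linarith)
    · intro hd
      rw [← ENNReal.tendsto_toReal_iff (fun n => measure_ne_top _ _) ENNReal.one_ne_top,
        ENNReal.toReal_one]
      refine tendsto_order.2 ⟨fun r hr => ?_,
        fun r hr => .of_forall fun n => (measureReal_le_one (μ := P n)).trans_lt hr⟩
      filter_upwards [svp_transition_window hc₁ (half_pos (sub_pos.2 hr)), hd, hwidth]
        with n h1 h2 h3
      rw [abs_lt] at h2
      have := (h1 (d n) (Ω n) (P n) (x n) (y n) (hxy n)).2 (by linarith)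
      exact lt_of_lt_of_le (by linarith) this
  · filter_upwards [svp_transition_window hc₁ hδ] with n h
    intro d Ω _ P _ x y hxy
    exact ⟨(h d Ω P x y hxy).1, fun hd _ => (h d Ω P x y hxy).2 hd⟩

end Asymptotics
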